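/- Let $\mathcal X,\mathcal S$ be finite alphabets and $\mathcal H_B$ a finite-dimensional Hilbert space. A sequence of classical-quantum Gel'fand–Pinsker channels consists, for every $n$, of an arbitrary probability distribution $p_{S^n}$ on $\mathcal S^n$ and density matrices $\rho^{B^n}_{x^n,s^n}$ on $\mathcal H_B^{\otimes n}$ ($x^n\in\mathcal X^n$, $s^n\in\mathcal S^n$); no stationarity or memorylessness is assumed. An $(n,M_n,M_{e,n},\varepsilon_n)$ code consists of a state encoding $f_{e,n}:\mathcal S^n\to[1:M_{e,n}]$, a (possibly randomized) encoding $f_n:[1:M_n]\times[1:M_{e,n}]\to\mathcal X^n$ and a decoding POVM $\{\beta(m)\}_{m\in[1:M_n]}$ on $\mathcal H_B^{\otimes n}$ with $$\frac1{M_n}\sum_{m=1}^{M_n}\sum_{s^n}p_{S^n}(s^n)\,\mathbb E\,\mathrm{Tr}\big[(\mathbb I-\beta(m))\,\rho^{B^n}_{f_n(m,f_{e,n}(s^n)),s^n}\big]\le\varepsilon_n,$$ the expectation being over the randomness of $f_n$. A pair $(R,R_S)$ of real numbers is achievable if for every $\varepsilon>0$ there is a sequence of $(n,M_n,M_{e,n},\varepsilon_n)$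 codes with $\liminf_n\frac1n\log_2M_n>R$, $\limsup_n\varepsilon_n<\varepsilon$ and $\limsup_n\frac1n\log_2M_{e,n}<R_S$. The capacity region is the closure in $\mathbb R^2$ of the set of achievable pairs. For a sequence of pairs of finitely-valued random variables $(A_n,C_n)$ with joint distributions $p_{A_nC_n}$ let $$\overline{\mathbf I}[\mathbf A;\mathbf C]=\inf\Big\{a\in\mathbb R:\ \lim_{n\to\infty}\Pr\Big\{\tfrac1n\log_2\tfrac{p_{A_nC_n}(A_n,C_n)}{p_{A_n}(A_n)p_{C_n}(C_n)}>a+\gamma\Big\}=0\ \text{ for all }\gamma>0\Big\},$$ and for sequences of density matrices $\rho_n,\sigma_n$ let $$\underline{\mathbf I}[\boldsymbol\rho;\boldsymbol\sigma]=\sup\Big\{a\in\mathbb R:\ \lim_{n\to\infty}\mathrm{Tr}\big[\{\rho_n\succeq2^{n(a-\gamma)}\sigma_n\}\rho_n\big]=1\ \text{ for all }\gamma>0\Big\},$$ both in $[-\infty,\infty]$, where $\{\rho_n\succeq c\,\sigma_n\}$ is the projection onto the nonnegative eigenspace of $\rho_n-c\,\sigma_n$. Consider all sequences of states of the form $$\Theta^{S^n\tilde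 S^nU^nX^nB^n}=\sum_{s^n,\tilde s^n,u^n,x^n}p_{S^n}(s^n)\,p_{\tilde S^n|S^n}(\tilde s^n|s^n)\,p_{U^n|\tilde S^n}(u^n|\tilde s^n)\,p_{X^n|U^n\tilde S^n}(x^n|u^n,\tilde s^n)\ |s^n\rangle\langle s^n|\otimes|\tilde s^n\rangle\langle\tilde s^n|\otimes|u^n\rangle\langle u^n|\otimes|x^n\rangle\langle x^n|\otimes\rho^{B^n}_{x^n,s^n},$$ where, for each $n$, $\tilde S^n$ and $U^n$ take values in arbitrary finite sets and the conditional distributions are arbitrary. Put $\underline{\mathbf I}[\mathbf U;\mathbf B]=\underline{\mathbf I}[\{\Theta^{U^nB^n}\};\{\Theta^{U^n}\otimes\Theta^{B^n}\}]$, and compute $\overline{\mathbf I}[\mathbf U;\tilde{\mathbf S}]$ and $\overline{\mathbf I}[\mathbf S;\tilde{\mathbf S}]$ from the corresponding marginal distributions. Theorem. The capacity region is exactly the set of all pairs $(R,R_S)\in\mathbb R^2$ for which there is such a sequence of states satisfying both $$R\le\underline{\mathbf I}[\mathbf U;\mathbf B]-\overline{\mathbf I}[\mathbf U;\tilde{\mathbf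 S}],\qquad R_S\ge\overline{\mathbf I}[\mathbf S;\tilde{\mathbf S}].$$ -/

import Mathlib

open Filter Topology Matrix
open scoped Kronecker ComplexOrder

namespace CQGP

noncomputable section

/-! ### Information-spectrum quantities -/

/-- First marginal of a joint probability mass function. -/
def marginalFst {A C : Type*} [Fintype C] (p : A → C → ℝ) (a : A) : ℝ := ∑ c, p a c

/-- Second marginal of a joint probability mass function. -/
def marginalSnd {A C : Type*} [Fintype A] (p : A → C → ℝ) (c : C) : ℝ := ∑ a, p a c

open Classical in
/-- The probability, under the joint distribution `p`, that the normalized information density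
`(1/n) log₂ (p(a,c) / (p(a) p(c)))` exceeds `x`. Pairs of probability zero do not contribute, and
for all others the marginals are positive. -/
def probInfoDensityGT {A C : Type*} [Fintype A] [Fintype C] (n : ℕ) (p : A → C → ℝ) (x : ℝ) : ℝ :=
  ∑ a, ∑ c, if x < (1 / (n : ℝ)) * Real.logb 2 (p a c / (marginalFst p a * marginalSnd p c))
    then p a c else 0

/-- Spectral-sup mutual information rate of a sequence of joint distributions, as an extended
real (it is `⊤` when no real number `a` is admissible). -/
def spectralSupInfo {A C : ℕ → Type*} [∀ n, Fintype (A n)] [∀ n, Fintype (C n)]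
    (p : ∀ n, A n → C n → ℝ) : EReal :=
  sInf {e : EReal | ∃ a : ℝ, e = (a : EReal) ∧
    ∀ γ : ℝ, 0 < γ → Tendsto (fun n : ℕ => probInfoDensityGT n (p n) (a + γ)) atTop (𝓝 0)}

/-- For a Hermitian matrix `A`, the orthogonal projection `{A ⪰ 0}` onto the span of the
eigenvectors of `A` with nonnegative eigenvalue. -/
def nonnegProj {ι : Type*} [Fintype ι] [DecidableEq ι] (A : Matrix ι ι ℂ) : Matrix ι ι ℂ :=
  cfc (Set.indicator (Set.Ici (0 : ℝ)) (fun _ => (1 : ℝ))) A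

/-- Spectral-inf information rate of a sequence of density matrices `ρ` with respect to `σ`, as an
extended real. -/
def spectralInfInfo {ι : ℕ → Type*} [∀ n, Fintype (ι n)] [∀ n, DecidableEq (ι n)]
    (ρ σ : ∀ n, Matrix (ι n) (ι n) ℂ) : EReal :=
  sSup {e : EReal | ∃ a : ℝ, e = (a : EReal) ∧ ∀ γ : ℝ, 0 < γ →
    Tendsto (fun n : ℕ => (trace
      (nonnegProj (ρ n - ((2 : ℝ) ^ ((n : ℝ) * (a - γ))) • σ n) * ρ n)).re) atTop (𝓝 1)}

/-! ### Channels and codes -/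

/-- A sequence of classical-quantum Gel'fand-Pinsker channels with state. For every blocklength
`n`, `stateDist n` is an arbitrary distribution of the state sequence, and `out x s` is a density
matrix on the `n`-fold tensor power of the output space; `B` indexes an orthonormal basis of the
output space, hence `Fin n → B` the product basis of its `n`-fold tensor power. -/
structure ChannelSeq (X S B : Type*) [Fintype S] [Fintype B] where
  /-- distribution of the state sequence -/
  stateDist : ∀ n : ℕ, (Fin n → S) → ℝ
  stateDist_mem : ∀ n, stateDist n ∈ stdSimplex ℝ (Fin n → S)
  /-- output state for input sequence `x` and state sequence `s` -/
  out : ∀ {n : ℕ}, (Fin n → X) → (Fin n → S) → Matrix (Fin n → B) (Fin n → B) ℂ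
  out_posSemidef : ∀ {n : ℕ} (x : Fin n → X) (s : Fin n → S), (out x s).PosSemidef
  out_trace : ∀ {n : ℕ} (x : Fin n → X) (s : Fin n → S), (out x s).trace = 1

/-- A code of blocklength `n`: `M` messages, state-encoder `stateEnc` with `Me` values, randomized
encoder `enc`, and decoding POVM `povm`. -/
structure Code (X S B : Type*) [Fintype X] [Fintype B] [DecidableEq B] (n : ℕ) where
  /-- number of messages -/
  M : ℕ
  M_pos : 0 < M
  /-- number of values of the coded state information -/
  Me : ℕ
  Me_pos : 0 < Me
  /-- state encoding -/
  stateEnc : (Fin n → S) → Fin Me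
  /-- `enc m k x` is the probability that the input `x` is sent given `m` and `k` -/
  enc : Fin M → Fin Me → (Fin n → X) → ℝ
  enc_mem : ∀ m k, enc m k ∈ stdSimplex ℝ (Fin n → X)
  /-- decoding measurement -/
  povm : Fin M → Matrix (Fin n → B) (Fin n → B) ℂ
  povm_posSemidef : ∀ m, (povm m).PosSemidef
  povm_sum : ∑ m, povm m = 1

variable {X S B : Type*} [Fintype X] [DecidableEq X] [Fintype S] [DecidableEq S]
  [Fintype B] [DecidableEq B]

/-- Error probability of a code, averaged over uniform messages, the state sequence and the
randomness of the encoder. -/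
def Code.error {n : ℕ} (C : Code X S B n) (N : ChannelSeq X S B) : ℝ :=
  (1 / (C.M : ℝ)) * ∑ m, ∑ s, N.stateDist n s *
    ∑ x, C.enc m (C.stateEnc s) x * (trace ((1 - C.povm m) * N.out x s)).re

/-- Achievable rate pairs: for every `ε > 0` there is a sequence of `(n, M_n, M_{e,n}, ε_n)` codes
with `liminf (1/n) log₂ M_n > R`, `limsup ε_n < ε` and `limsup (1/n) log₂ M_{e,n} < R_S`. -/
def Achievable (N : ChannelSeq X S B) (R RS : ℝ) : Prop :=
  ∀ ε : ℝ, 0 < ε → ∃ (C : ∀ n, Code X S B n) (e : ℕ → ℝ),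
    (∀ n, (C n).error N ≤ e n) ∧
    (R : EReal) < liminf (fun n : ℕ => (((1 / (n : ℝ)) * Real.logb 2 (C n).M : ℝ) : EReal)) atTop ∧
    limsup (fun n : ℕ => (e n : EReal)) atTop < (ε : EReal) ∧
    limsup (fun n : ℕ => (((1 / (n : ℝ)) * Real.logb 2 (C n).Me : ℝ) : EReal)) atTop < (RS : EReal)

/-- Capacity region: the closure in `ℝ × ℝ` of the set of achievable rate pairs. -/
def capacityRegion (N : ChannelSeq X S B) : Set (ℝ × ℝ) :=
  closure {r : ℝ × ℝ | Achievable N r.1 r.2}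

/-! ### Classical-quantum states of Markov form -/

/-- Conditional distributions `p(s̃|s)`, `p(u|s̃)`, `p(x|u,s̃)` at blocklength `n`, with finite
auxiliary alphabets `T` (for `s̃`) and `U`. -/
structure AuxKernels (X S : Type*) [Fintype X] (T U : Type*) [Fintype T] [Fintype U] (n : ℕ) where
  /-- `pT s t` is `p(s̃ = t | s)` -/
  pT : (Fin n → S) → T → ℝ
  pT_mem : ∀ s, pT s ∈ stdSimplex ℝ T
  /-- `pU t u` is `p(u | s̃ = t)` -/
  pU : T → U → ℝ
  pU_mem : ∀ t, pU t ∈ stdSimplex ℝ U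
  /-- `pX u t x` is `p(x | u, s̃ = t)` -/
  pX : U → T → (Fin n → X) → ℝ
  pX_mem : ∀ u t, pX u t ∈ stdSimplex ℝ (Fin n → X)

namespace AuxKernels

variable {T U : Type*} [Fintype T] [DecidableEq T] [Fintype U] [DecidableEq U] {n : ℕ}

/-- Joint distribution `p(s) p(s̃|s) p(u|s̃) p(x|u,s̃)`. -/
def joint (N : ChannelSeq X S B) (P : AuxKernels X S T U n)
    (s : Fin n → S) (t : T) (u : U) (x : Fin n → X) : ℝ :=
  N.stateDist n s * P.pT s t * P.pU t u * P.pX u t x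

/-- Joint distribution of `(S^n, S̃^n)`. -/
def jointST (N : ChannelSeq X S B) (P : AuxKernels X S T U n) (s : Fin n → S) (t : T) : ℝ :=
  ∑ u, ∑ x, P.joint N s t u x

/-- Joint distribution of `(U^n, S̃^n)`. -/
def jointUT (N : ChannelSeq X S B) (P : AuxKernels X S T U n) (u : U) (t : T) : ℝ :=
  ∑ s, ∑ x, P.joint N s t u x

/-- The state `Θ` on `S^n S̃^n U^n X^n B^n`; `Matrix.single a a 1` is `|a⟩⟨a|`. -/
def state (N : ChannelSeq X S B) (P : AuxKernels X S T U n) :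
    Matrix ((Fin n → S) × T × U × (Fin n → X) × (Fin n → B))
      ((Fin n → S) × T × U × (Fin n → X) × (Fin n → B)) ℂ :=
  ∑ s, ∑ t, ∑ u, ∑ x, P.joint N s t u x •
    (single s s (1 : ℂ) ⊗ₖ (single t t (1 : ℂ) ⊗ₖ (single u u (1 : ℂ) ⊗ₖ
      (single x x (1 : ℂ) ⊗ₖ N.out x s))))

/-- The reduced state on `U^n B^n` (partial trace over `S^n`, `S̃^n`, `X^n`). -/
def stateUB (N : ChannelSeq X S B) (P : AuxKernels X S T U n) :
    Matrix (U × (Fin n → B)) (U × (Fin n → B)) ℂ :=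
  of fun i j => ∑ s, ∑ t, ∑ x, P.state N (s, t, i.1, x, i.2) (s, t, j.1, x, j.2)

/-- The reduced state on `U^n`. -/
def stateU (N : ChannelSeq X S B) (P : AuxKernels X S T U n) : Matrix U U ℂ :=
  of fun u u' => ∑ b, P.stateUB N (u, b) (u', b)

/-- The reduced state on `B^n`. -/
def stateB (N : ChannelSeq X S B) (P : AuxKernels X S T U n) :
    Matrix (Fin n → B) (Fin n → B) ℂ :=
  of fun b b' => ∑ u, P.stateUB N (u, b) (u, b')

end AuxKernels

/-- The spectral-inf quantum mutual information rate between `U` and `B`, i.e. that of the states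
`Θ^{UB}` with respect to `Θ^U ⊗ Θ^B`. -/
def infoUB (N : ChannelSeq X S B) {T U : ℕ → Type*} [∀ n, Fintype (T n)] [∀ n, DecidableEq (T n)]
    [∀ n, Fintype (U n)] [∀ n, DecidableEq (U n)]
    (P : ∀ n, AuxKernels X S (T n) (U n) n) : EReal :=
  spectralInfInfo (fun n => (P n).stateUB N) (fun n => (P n).stateU N ⊗ₖ (P n).stateB N)

/-- The spectral-sup mutual information rate between `U` and `S̃`. -/
def infoUT (N : ChannelSeq X S B) {T U : ℕ → Type*} [∀ n, Fintype (T n)] [∀ n, Fintype (U n)]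
    (P : ∀ n, AuxKernels X S (T n) (U n) n) : EReal :=
  spectralSupInfo (fun n => (P n).jointUT N)

/-- The spectral-sup mutual information rate between `S` and `S̃`. -/
def infoST (N : ChannelSeq X S B) {T U : ℕ → Type*} [∀ n, Fintype (T n)] [∀ n, Fintype (U n)]
    (P : ∀ n, AuxKernels X S (T n) (U n) n) : EReal :=
  spectralSupInfo (fun n => (P n).jointST N)

end

end CQGP

/-!
Direct part. Draw `Me` state descriptions from the law of `S̃ⁿ` and, for each message, `J`
codewords from the law of `Uⁿ`, independently of everything else. A rejection sampler picks from a
list of about `2 ^ (n I̅[S; S̃])` descriptions one that is distributed almost like `p(s̃ | s)`, and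
from a list of about `2 ^ (n I̅[U; S̃])` codewords one that is distributed almost like `p(u | s̃)`;
the price is a factor `Me / K` in front of the error of the decoder, which the spectral test of
`Θ^{UB}` against `Θ^U ⊗ Θ^B` makes small through the Hayashi–Nagaoka inequality. The decoder has to
resolve all codewords, so `R + I̅[U; S̃] < I̲[U; B]` suffices.

Converse part. A code is itself a choice of auxiliary variables: `S̃ⁿ` is the encoded state and
`Uⁿ` the message, which is uniform and independent of `S̃ⁿ`, so that `I̅[U; S̃] ≤ 0`. The
cardinality of the range of `S̃ⁿ` bounds `I̅[S; S̃]`, and the decoder is a test that detects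
`Θ^{UB}` but accepts `Θ^U ⊗ Θ^B` only with probability `1 / M`, which bounds `I̲[U; B]` from below.
-/

namespace CQGP

section HayashiNagaoka

variable {A : Type*} [CStarAlgebra A] [PartialOrder A] [StarOrderedRing A]

open CFC in
theorem le_rpow_half_add {S T : A} (hS : 0 ≤ S) (hS1 : S ≤ 1) (hT : 0 ≤ T) :
    S ≤ (S + T) ^ (1 / 2 : ℝ) := by
  have hSS : S * S ≤ S := by
    have h := Commute.mul_nonneg hS (sub_nonneg.mpr hS1) ((Commute.one_right S).sub_right rfl)
    rwa [mul_sub, mul_one, sub_nonneg] at h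
  calc S = sqrt (S * S) := (sqrt_mul_self S).symm
    _ ≤ sqrt (S + T) := sqrt_le_sqrt _ _ (hSS.trans (le_add_of_nonneg_right hT))
    _ = (S + T) ^ (1 / 2 : ℝ) := sqrt_eq_rpow

theorem hayashi_nagaoka {S T : A} (hS : 0 ≤ S) (hS1 : S ≤ 1) (hT : 0 ≤ T)
    (hST : IsStrictlyPositive (S + T)) :
    1 - (S + T) ^ (-(1 / 2) : ℝ) * S * (S + T) ^ (-(1 / 2) : ℝ) ≤
      (2 : ℝ) • (1 - S) + (4 : ℝ) • T := by
  have hRS := le_rpow_half_add hS hS1 hT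
  have hRG := CFC.rpow_mul_rpow_neg (1 / 2 : ℝ) hST
  have hGR := CFC.rpow_neg_mul_rpow (1 / 2 : ℝ) hST
  have hRR : (S + T) ^ (1 / 2 : ℝ) * (S + T) ^ (1 / 2 : ℝ) = S + T := by
    rw [← CFC.rpow_add hST.isUnit, add_halves, CFC.rpow_one _]
  have hG : IsSelfAdjoint ((S + T) ^ (-(1 / 2) : ℝ)) := CFC.rpow_nonneg.isSelfAdjoint
  generalize (S + T) ^ (1 / 2 : ℝ) = R at *
  generalize (S + T) ^ (-(1 / 2) : ℝ) = G at *
  obtain rfl : T = R * R - S := by rw [hRR, add_sub_cancel_left]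
  have hS' := (hG.sub (.one A)).conjugate_nonneg hS
  have hT' := (hG.sub ((IsSelfAdjoint.all (2 : ℝ)).smul (.one A))).conjugate_nonneg hT
  have hGRRG : G * (R * R) * G = 1 := by rw [← mul_assoc, hGR, one_mul, hRG]
  have hGRR : G * (R * R) = R := by rw [← mul_assoc, hGR, one_mul]
  have hRRG : R * R * G = R := by rw [mul_assoc, hRG, mul_one]
  -- The defect is a sum of three terms that are visibly nonnegative.
  have key : (2 : ℝ) • (1 - S) + (4 : ℝ) • (R * R - S) - (1 - G * S * G) =
      (4 : ℝ) • (R - S) + (2 : ℝ) • ((G - 1) * S * (G - 1)) +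
        (G - (2 : ℝ) • 1) * (R * R - S) * (G - (2 : ℝ) • 1) := by
    have expand : (G - (2 : ℝ) • 1) * (R * R - S) * (G - (2 : ℝ) • 1) =
        G * (R * R) * G - G * S * G - (2 : ℝ) • (G * (R * R) - G * S) -
          (2 : ℝ) • (R * R * G - S * G) + (4 : ℝ) • (R * R - S) := by
      simp only [sub_mul, mul_sub, smul_mul_assoc, mul_smul_comm, one_mul, mul_one]
      module
    rw [expand, hGRRG, hGRR, hRRG]
    simp only [sub_mul, mul_sub, one_mul, mul_one]
    module
  rw [← sub_nonneg, key]
  have := sub_nonneg.mpr hRS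
  positivity

theorem exists_squareRoot_measurement {κ : Type*} [Fintype κ] [DecidableEq κ] {Λ : κ → A}
    (h0 : ∀ i, 0 ≤ Λ i) (h1 : ∀ i, Λ i ≤ 1) {δ : ℝ} (hδ : 0 < δ) :
    ∃ γ : κ → A, (∀ i, 0 ≤ γ i) ∧ ∑ i, γ i ≤ 1 ∧ ∀ i,
      1 - γ i ≤ (2 : ℝ) • (1 - Λ i) + (4 : ℝ) • (∑ j ∈ Finset.univ.erase i, Λ j + δ • 1) := by
  have hδ1 : IsStrictlyPositive (δ • (1 : A)) := isStrictlyPositive_one.smul hδ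
  have hD : IsStrictlyPositive (∑ i, Λ i + δ • 1) :=
    IsStrictlyPositive.nonneg_add (Finset.sum_nonneg fun i _ => h0 i) hδ1
  have hsplit (i : κ) :
      Λ i + (∑ j ∈ Finset.univ.erase i, Λ j + δ • 1) = ∑ i, Λ i + δ • 1 := by
    rw [← add_assoc, Finset.add_sum_erase _ _ (Finset.mem_univ i)]
  set D := ∑ i, Λ i + δ • (1 : A)
  set G := D ^ (-(1 / 2) : ℝ)
  have hG : IsSelfAdjoint G := CFC.rpow_nonneg.isSelfAdjoint
  have hGDG : G * D * G = 1 := CFC.conjugate_rpow_neg_one_half D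
  refine ⟨fun i => G * Λ i * G, fun i => hG.conjugate_nonneg (h0 i), ?_, fun i => ?_⟩
  · rw [← Finset.sum_mul, ← Finset.mul_sum, ← hGDG]
    exact hG.conjugate_le_conjugate (le_add_of_nonneg_right hδ1.nonneg)
  · have h := hayashi_nagaoka (h0 i) (h1 i)
      (add_nonneg (Finset.sum_nonneg fun j _ => h0 j) hδ1.nonneg) (hsplit i ▸ hD)
    rwa [hsplit] at h

end HayashiNagaoka

theorem exists_povm_of_sum_le_one {A κ M : Type*} [Ring A] [PartialOrder A] [IsOrderedAddMonoid A]
    [Fintype κ] [Fintype M] [Nonempty M] (π : κ → M) {γ : κ → A}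
    (h0 : ∀ i, 0 ≤ γ i) (h1 : ∑ i, γ i ≤ 1) :
    ∃ β : M → A, (∀ m, 0 ≤ β m) ∧ ∑ m, β m = 1 ∧ ∀ i, γ i ≤ β (π i) := by
  classical
  obtain ⟨m₀⟩ := ‹Nonempty M›
  have hrest : ∀ m, 0 ≤ if m = m₀ then 1 - ∑ i, γ i else 0 := fun m => by
    split_ifs
    exacts [sub_nonneg.mpr h1, le_rfl]
  refine ⟨fun m => ∑ i with π i = m, γ i + if m = m₀ then 1 - ∑ i, γ i else 0,
    fun m => add_nonneg (Finset.sum_nonneg fun i _ => h0 i) (hrest m), ?_, fun i => ?_⟩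
  · rw [Finset.sum_add_distrib, Finset.sum_fiberwise _ π, Finset.sum_ite_eq' Finset.univ m₀,
      if_pos (Finset.mem_univ _), add_sub_cancel]
  · exact (Finset.single_le_sum (fun j _ => h0 j) (by simp)).trans
      (le_add_of_nonneg_right (hrest _))

section Born

open scoped MatrixOrder

variable {ι : Type*} [Fintype ι] {A B C : Matrix ι ι ℂ}

/-- The Born rule: the probability `Re Tr (T ρ)` that a measurement of the state `ρ` gives the
outcome with effect `T`, as a real-bilinear form on all matrices. -/
noncomputable def born : Matrix ι ι ℂ →ₗ[ℝ] Matrix ι ι ℂ →ₗ[ℝ] ℝ :=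
  (LinearMap.mul ℝ _).compr₂ (Complex.reLm ∘ₗ traceLinearMap ι ℝ ℂ)

theorem born_apply (T ρ : Matrix ι ι ℂ) : born T ρ = (trace (T * ρ)).re := rfl

theorem born_nonneg (hA : 0 ≤ A) (hB : 0 ≤ B) : 0 ≤ born A B := by
  classical
  obtain ⟨R, rfl⟩ := CStarAlgebra.nonneg_iff_eq_star_mul_self.mp hA
  rw [born_apply, Matrix.mul_assoc, trace_mul_comm]
  exact (Complex.nonneg_iff.mp
    ((nonneg_iff_posSemidef.mp hB).mul_mul_conjTranspose_same R).trace_nonneg).1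

theorem born_mono_left (hAB : A ≤ B) (hC : 0 ≤ C) : born A C ≤ born B C := by
  have h := born_nonneg (sub_nonneg.mpr hAB) hC
  rwa [map_sub, LinearMap.sub_apply, sub_nonneg] at h

theorem born_mono_right (hA : 0 ≤ A) (hBC : B ≤ C) : born A B ≤ born A C := by
  have h := born_nonneg hA (sub_nonneg.mpr hBC)
  rwa [map_sub, sub_nonneg] at h

variable [DecidableEq ι]

theorem nonnegProj_nonneg (A : Matrix ι ι ℂ) : 0 ≤ nonnegProj A :=
  cfc_nonneg fun _ _ => Set.indicator_nonneg (fun _ _ => zero_le_one) _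

theorem nonnegProj_le_one (A : Matrix ι ι ℂ) : nonnegProj A ≤ 1 :=
  cfc_le_one _ _ fun _ _ => Set.indicator_le_self' (fun _ _ => zero_le_one) _

theorem continuousOn_spectrum_real (hA : A.IsHermitian) (f : ℝ → ℝ) :
    ContinuousOn f (spectrum ℝ A) := by
  rw [hA.spectrum_real_eq_range_eigenvalues]
  exact (Set.finite_range _).continuousOn f

theorem nonnegProj_mul_self_eq_cfc (hA : A.IsHermitian) :
    nonnegProj A * A = cfc (fun x : ℝ => max x 0) A := by
  have hc := continuousOn_spectrum_real hA
  have hid : cfc (fun x : ℝ => x) A = A := cfc_id' ℝ A hA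
  nth_rw 2 [← hid]
  rw [nonnegProj, ← cfc_mul _ _ A (hc _) (hc _)]
  congr with x
  by_cases hx : 0 ≤ x
  · simp [hx]
  · simp [hx, (not_le.mp hx).le]

theorem nonnegProj_mul_self_nonneg (hA : A.IsHermitian) : 0 ≤ nonnegProj A * A := by
  rw [nonnegProj_mul_self_eq_cfc hA]
  exact cfc_nonneg fun _ _ => le_max_right _ _

theorem le_nonnegProj_mul_self (hA : A.IsHermitian) : A ≤ nonnegProj A * A := by
  have hc := continuousOn_spectrum_real hA
  rw [nonnegProj_mul_self_eq_cfc hA]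
  have hid : cfc (fun x : ℝ => x) A = A := cfc_id' ℝ A hA
  nth_rw 1 [← hid]
  exact cfc_mono (fun _ _ => le_max_left _ _) (hc _) (hc _)

theorem born_le_born_nonnegProj {T : Matrix ι ι ℂ} (hA : A.IsHermitian) (hT : 0 ≤ T)
    (hT1 : T ≤ 1) : born T A ≤ born (nonnegProj A) A :=
  calc born T A ≤ born T (nonnegProj A * A) := born_mono_right hT (le_nonnegProj_mul_self hA)
    _ ≤ born 1 (nonnegProj A * A) := born_mono_left hT1 (nonnegProj_mul_self_nonneg hA)
    _ = born (nonnegProj A) A := by rw [born_apply, Matrix.one_mul, born_apply]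

end Born

section RandomCodebook

variable {ι U : Type*} [Fintype ι] [Fintype U] [DecidableEq ι]

/-- Expectation of `F` over a random codebook, i.e. a family indexed by `ι` of letters drawn
independently from the distribution `w`. -/
noncomputable def iidExp (w : U → ℝ) (F : (ι → U) → ℝ) : ℝ :=
  ∑ ω : ι → U, (∏ i, w (ω i)) * F ω

theorem iidExp_add (w : U → ℝ) (F G : (ι → U) → ℝ) :
    iidExp w (fun ω => F ω + G ω) = iidExp w F + iidExp w G := by
  simp [iidExp, mul_add, Finset.sum_add_distrib]

theorem iidExp_mul_left (w : U → ℝ) (c : ℝ) (F : (ι → U) → ℝ) :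
    iidExp w (fun ω => c * F ω) = c * iidExp w F := by
  simp only [iidExp, Finset.mul_sum]
  exact Finset.sum_congr rfl fun _ _ => by ring

theorem iidExp_sum {κ : Type*} (s : Finset κ) (w : U → ℝ) (F : κ → (ι → U) → ℝ) :
    iidExp w (fun ω => ∑ k ∈ s, F k ω) = ∑ k ∈ s, iidExp w (F k) := by
  simp only [iidExp, Finset.mul_sum]
  exact Finset.sum_comm

theorem iidExp_prod (w : U → ℝ) (g : ι → U → ℝ) :
    iidExp w (fun ω => ∏ i, g i (ω i)) = ∏ i, ∑ u, w u * g i u := by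
  simp only [iidExp, ← Finset.prod_mul_distrib]
  exact (Fintype.prod_sum fun i u => w u * g i u).symm

variable {w : U → ℝ}

theorem iidExp_const (hw : ∑ u, w u = 1) (c : ℝ) : iidExp (ι := ι) w (fun _ => c) = c := by
  have h := iidExp_prod (ι := ι) w (fun _ _ => 1)
  have h' := iidExp_mul_left (ι := ι) w c (fun _ => 1)
  simp only [Finset.prod_const_one, mul_one, hw] at h h'
  rw [h', h, mul_one]

theorem iidExp_prod_subset (hw : ∑ u, w u = 1) (s : Finset ι) (g : ι → U → ℝ) :
    iidExp w (fun ω => ∏ i ∈ s, g i (ω i)) = ∏ i ∈ s, ∑ u, w u * g i u := by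
  have h := iidExp_prod w (fun i u => if i ∈ s then g i u else 1)
  simp only [Finset.prod_ite_mem, Finset.univ_inter] at h
  rw [h, ← Finset.prod_subset (Finset.subset_univ s)]
  · exact Finset.prod_congr rfl fun i hi => by simp [hi]
  · intro i _ hi
    simp [hi, hw]

theorem iidExp_eval (hw : ∑ u, w u = 1) (i : ι) (f : U → ℝ) :
    iidExp w (fun ω => f (ω i)) = ∑ u, w u * f u := by
  have := iidExp_prod_subset hw {i} (fun _ => f)
  simpa using this

theorem iidExp_eval_two (hw : ∑ u, w u = 1) {i j : ι} (hij : i ≠ j)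
    (f : U → U → ℝ) :
    iidExp w (fun ω => f (ω i) (ω j)) = ∑ u, ∑ v, w u * w v * f u v := by
  classical
  have h : ∀ ω : ι → U, f (ω i) (ω j) = ∑ v, ∏ k ∈ {i, j},
      (fun k u => if k = i then f u v else if u = v then 1 else 0) k (ω k) := by
    intro ω
    simp [Finset.prod_pair hij, hij.symm]
  simp only [h]
  rw [iidExp_sum, Finset.sum_comm]
  refine Finset.sum_congr rfl fun v _ => ?_
  have h2 := iidExp_prod_subset hw {i, j}
    (fun k u => if k = i then f u v else if u = v then 1 else 0)
  rw [Finset.prod_pair hij] at h2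
  rw [h2]
  simp only [if_true, hij.symm, if_false, mul_ite, mul_one, mul_zero, Finset.sum_ite_eq',
    Finset.mem_univ, Finset.sum_mul]
  exact Finset.sum_congr rfl fun u _ => by ring

theorem exists_le_iidExp (hw : ∀ u, 0 ≤ w u) (hw1 : ∑ u, w u = 1) (F : (ι → U) → ℝ) :
    ∃ ω, F ω ≤ iidExp w F := by
  by_contra! h
  have hne : ∃ ω : ι → U, 0 < ∏ i, w (ω i) := by
    obtain ⟨u, hu⟩ : ∃ u, 0 < w u := by
      by_contra! h0
      have : ∑ u, w u ≤ 0 := Finset.sum_nonpos fun u _ => h0 u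
      linarith
    exact ⟨fun _ => u, Finset.prod_pos fun _ _ => hu⟩
  obtain ⟨ω₀, hω₀⟩ := hne
  have hlt : iidExp w (fun _ : ι → U => iidExp w F) < iidExp w F :=
    Finset.sum_lt_sum
      (fun ω _ => mul_le_mul_of_nonneg_left (h ω).le (Finset.prod_nonneg fun _ _ => hw _))
      ⟨ω₀, Finset.mem_univ _, mul_lt_mul_of_pos_left (h ω₀) hω₀⟩
  rw [iidExp_const hw1] at hlt
  exact lt_irrefl _ hlt

end RandomCodebook

section RejectionSampling

theorem one_le_sum_add_prod_one_sub {J : Type*} (s : Finset J) (a : J → ℝ) (h0 : ∀ j, 0 ≤ a j)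
    (h1 : ∀ j, a j ≤ 1) : 1 ≤ ∑ j ∈ s, a j + ∏ j ∈ s, (1 - a j) := by
  classical
  induction s using Finset.induction_on with
  | empty => simp
  | insert j s hj ih =>
    rw [Finset.sum_insert hj, Finset.prod_insert hj]
    have hp : ∏ j ∈ s, (1 - a j) ≤ 1 :=
      Finset.prod_le_one (fun j _ => by linarith [h1 j]) fun j _ => by linarith [h0 j]
    nlinarith [h0 j]

theorem exists_le_sum_mul_add_prod {J : Type*} [Fintype J] [Nonempty J] (a c : J → ℝ) (b : ℝ)
    (h0 : ∀ j, 0 ≤ a j) (h1 : ∀ j, a j ≤ 1) (hc0 : ∀ j, 0 ≤ c j) (hcb : ∀ j, c j ≤ b) :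
    ∃ j, c j ≤ ∑ j, a j * c j + b * ∏ j, (1 - a j) := by
  obtain ⟨j₀, hj₀⟩ := Finite.exists_min c
  refine ⟨j₀, ?_⟩
  have h := mul_le_mul_of_nonneg_left (one_le_sum_add_prod_one_sub Finset.univ a h0 h1) (hc0 j₀)
  have hs : c j₀ * ∑ j, a j ≤ ∑ j, a j * c j := by
    rw [Finset.mul_sum]
    exact Finset.sum_le_sum fun j _ => by
      rw [mul_comm]; exact mul_le_mul_of_nonneg_left (hj₀ j) (h0 j)
  have hp : c j₀ * ∏ j, (1 - a j) ≤ b * ∏ j, (1 - a j) :=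
    mul_le_mul_of_nonneg_right (hcb j₀) (Finset.prod_nonneg fun j _ => by linarith [h1 j])
  linarith

variable {Y : Type*} {q v : Y → ℝ} {K : ℝ}

open Classical in
/-- Acceptance probability of rejection sampling: a sample `y` drawn from `q` and accepted with
this probability is distributed as `v / K` on the set where `v ≤ K • q`. It is `0` elsewhere, and
also (as `0 / 0`) where both distributions vanish. -/
noncomputable def acceptProb (q v : Y → ℝ) (K : ℝ) (y : Y) : ℝ :=
  if v y ≤ K * q y then v y / (K * q y) else 0

theorem acceptProb_nonneg (hq : ∀ y, 0 ≤ q y) (hv : ∀ y, 0 ≤ v y) (hK : 0 < K) (y : Y) :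
    0 ≤ acceptProb q v K y := by
  unfold acceptProb
  split_ifs
  · exact div_nonneg (hv y) (mul_nonneg hK.le (hq y))
  · exact le_rfl

theorem acceptProb_le_one (hq : ∀ y, 0 ≤ q y) (hK : 0 < K) (y : Y) : acceptProb q v K y ≤ 1 := by
  unfold acceptProb
  split_ifs with h
  · exact div_le_one_of_le₀ h (mul_nonneg hK.le (hq y))
  · exact zero_le_one

open Classical in
theorem mul_acceptProb (hq : ∀ y, 0 ≤ q y) (hv : ∀ y, 0 ≤ v y) (hK : 0 < K) (y : Y) :
    q y * acceptProb q v K y = (v y - if K * q y < v y then v y else 0) / K := by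
  unfold acceptProb
  by_cases h : v y ≤ K * q y
  · rw [if_pos h, if_neg (not_lt.mpr h), sub_zero]
    rcases (hq y).eq_or_lt with h0 | h0
    · rw [← h0, mul_zero] at h
      rw [← h0, le_antisymm h (hv y), zero_mul, zero_div]
    · field_simp
  · rw [if_neg h, if_pos (not_le.mp h), mul_zero, sub_self, zero_div]

theorem mul_acceptProb_le (hq : ∀ y, 0 ≤ q y) (hv : ∀ y, 0 ≤ v y) (hK : 0 < K) (y : Y) :
    q y * acceptProb q v K y ≤ v y / K := by
  rw [mul_acceptProb hq hv hK]
  gcongr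
  split_ifs <;> linarith [hv y]

variable [Fintype Y]

open Classical in
/-- The mass that `v` puts where it exceeds `K • q`. -/
noncomputable def excessMass (q v : Y → ℝ) (K : ℝ) : ℝ := ∑ y, if K * q y < v y then v y else 0

theorem sum_mul_acceptProb (hq : ∀ y, 0 ≤ q y) (hv : v ∈ stdSimplex ℝ Y) (hK : 0 < K) :
    ∑ y, q y * acceptProb q v K y = (1 - excessMass q v K) / K := by
  simp only [mul_acceptProb hq hv.1 hK]
  rw [← Finset.sum_div, Finset.sum_sub_distrib, hv.2, excessMass]

theorem excessMass_nonneg (hv : ∀ y, 0 ≤ v y) : 0 ≤ excessMass q v K :=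
  Finset.sum_nonneg fun y _ => by split_ifs; exacts [hv y, le_rfl]

theorem excessMass_le_one (hv : v ∈ stdSimplex ℝ Y) : excessMass q v K ≤ 1 := by
  rw [← hv.2]
  exact Finset.sum_le_sum fun y _ => by split_ifs; exacts [le_rfl, hv.1 y]

theorem one_sub_div_pow_le {e : ℝ} (he0 : 0 ≤ e) (he1 : e ≤ 1) (h : (1 - e) / K ≤ 1) (J : ℕ) :
    (1 - (1 - e) / K) ^ J ≤ e + Real.exp (-(J / K)) := by
  have hexp : (1 - (1 - e) / K) ^ J ≤ Real.exp ((1 - e) * -(J / K)) :=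
    calc (1 - (1 - e) / K) ^ J ≤ Real.exp (-((1 - e) / K)) ^ J :=
          pow_le_pow_left₀ (sub_nonneg.mpr h) (Real.one_sub_le_exp_neg _) J
      _ = Real.exp ((1 - e) * -(J / K)) := by rw [← Real.exp_nat_mul]; ring_nf
  have hconv := convexOn_exp.2 (Set.mem_univ (0 : ℝ)) (Set.mem_univ (-(J / K))) he0
    (sub_nonneg.mpr he1) (by ring)
  simp only [smul_eq_mul, mul_zero, zero_add, Real.exp_zero, mul_one] at hconv
  nlinarith [Real.exp_pos (-(J / K))]

theorem prob_no_accept_pow_le (hq : q ∈ stdSimplex ℝ Y) (hv : v ∈ stdSimplex ℝ Y) (hK : 0 < K)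
    (J : ℕ) : (∑ y, q y * (1 - acceptProb q v K y)) ^ J ≤
      excessMass q v K + Real.exp (-(J / K)) := by
  have hsum : ∑ y, q y * (1 - acceptProb q v K y) = 1 - (1 - excessMass q v K) / K := by
    simp only [mul_sub, mul_one, Finset.sum_sub_distrib, hq.2, sum_mul_acceptProb hq.1 hv hK]
  have h0 : 0 ≤ ∑ y, q y * (1 - acceptProb q v K y) := Finset.sum_nonneg fun y _ =>
    mul_nonneg (hq.1 y) (sub_nonneg.mpr (acceptProb_le_one hq.1 hK y))
  rw [hsum] at h0 ⊢
  exact one_sub_div_pow_le (excessMass_nonneg hv.1) (excessMass_le_one hv) (sub_nonneg.mp h0) J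

variable {ι J : Type*} [Fintype ι] [DecidableEq ι] [Fintype J]

theorem iidExp_accept_mul_le (hq : q ∈ stdSimplex ℝ Y) (hv : ∀ y, 0 ≤ v y) (hK : 0 < K) (i : ι)
    {g : Y → ℝ} (hg : ∀ y, 0 ≤ g y) {c : Y → Y → ℝ} (hc : ∀ y y', 0 ≤ c y y') :
    iidExp q (fun ω : ι → Y => acceptProb q v K (ω i) *
        (g (ω i) + ∑ i' ∈ Finset.univ.erase i, c (ω i) (ω i'))) ≤
      (∑ y, v y * g y + Fintype.card ι * ∑ y, v y * ∑ y', q y' * c y y') / K := by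
  classical
  set a := acceptProb q v K
  have hself : iidExp q (fun ω : ι → Y => a (ω i) * g (ω i)) ≤ (∑ y, v y * g y) / K := by
    rw [iidExp_eval hq.2 i fun y => a y * g y, Finset.sum_div]
    refine Finset.sum_le_sum fun y _ => ?_
    rw [← mul_assoc, mul_div_right_comm]
    exact mul_le_mul_of_nonneg_right (mul_acceptProb_le hq.1 hv hK y) (hg y)
  have hcq : ∀ y, 0 ≤ ∑ y', q y' * c y y' := fun y =>
    Finset.sum_nonneg fun y' _ => mul_nonneg (hq.1 y') (hc y y')
  have hpair : ∀ i' ∈ Finset.univ.erase i,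
      iidExp q (fun ω : ι → Y => a (ω i) * c (ω i) (ω i')) ≤
        (∑ y, v y * ∑ y', q y' * c y y') / K := by
    intro i' hi'
    rw [iidExp_eval_two hq.2 (Finset.ne_of_mem_erase hi').symm fun y y' => a y * c y y',
      Finset.sum_div]
    refine Finset.sum_le_sum fun y _ => ?_
    calc ∑ y', q y * q y' * (a y * c y y') = q y * a y * ∑ y', q y' * c y y' := by
          rw [Finset.mul_sum]
          exact Finset.sum_congr rfl fun y' _ => by ring
      _ ≤ v y / K * ∑ y', q y' * c y y' :=
          mul_le_mul_of_nonneg_right (mul_acceptProb_le hq.1 hv hK y) (hcq y)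
      _ = v y * (∑ y', q y' * c y y') / K := div_mul_eq_mul_div _ _ _
  have hX : 0 ≤ (∑ y, v y * ∑ y', q y' * c y y') / K :=
    div_nonneg (Finset.sum_nonneg fun y _ => mul_nonneg (hv y) (hcq y)) hK.le
  have hcard : ((Finset.univ.erase i).card : ℝ) ≤ Fintype.card ι :=
    mod_cast Finset.card_erase_le
  simp only [mul_add, Finset.mul_sum _ _ (a _)]
  rw [iidExp_add, iidExp_sum, add_div, mul_div_assoc]
  refine add_le_add hself ((Finset.sum_le_card_nsmul _ _ _ hpair).trans ?_)
  rw [nsmul_eq_mul]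
  exact mul_le_mul_of_nonneg_right hcard hX

theorem iidExp_selection_le (hq : q ∈ stdSimplex ℝ Y) (hv : v ∈ stdSimplex ℝ Y) (hK : 0 < K)
    (e : J ↪ ι) {g : Y → ℝ} (hg : ∀ y, 0 ≤ g y) {c : Y → Y → ℝ} (hc : ∀ y y', 0 ≤ c y y')
    {b : ℝ} (hb : 0 ≤ b) :
    iidExp q (fun ω : ι → Y => ∑ j, acceptProb q v K (ω (e j)) *
        (g (ω (e j)) + ∑ i ∈ Finset.univ.erase (e j), c (ω (e j)) (ω i)) +
          b * ∏ j, (1 - acceptProb q v K (ω (e j)))) ≤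
      Fintype.card J / K *
        (∑ y, v y * g y + Fintype.card ι * ∑ y, v y * ∑ y', q y' * c y y') +
      b * (excessMass q v K + Real.exp (-(Fintype.card J / K))) := by
  rw [iidExp_add, iidExp_sum, iidExp_mul_left]
  gcongr
  · refine (Finset.sum_le_card_nsmul _ _ _ fun j _ =>
      iidExp_accept_mul_le hq hv.1 hK (e j) hg hc).trans_eq ?_
    rw [Finset.card_univ, nsmul_eq_mul, mul_div_assoc', div_mul_eq_mul_div]
  · have hprod := iidExp_prod_subset hq.2 (Finset.univ.map e) fun _ y => 1 - acceptProb q v K y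
    simp only [Finset.prod_map, Finset.prod_const, Finset.card_map, Finset.card_univ] at hprod
    rw [hprod]
    exact prob_no_accept_pow_le hq hv hK _

/-- Every one of the `|M|` messages owns `|J|` random codewords, and the codewords `ω i` with
`i ≠ (m, j)` interfere with the use of `ω (m, j)` at cost `c`. The codebook does not depend on the
actual costs `h`, so that a decoder can be built from it. -/
theorem exists_codebook_forall_selection {T M : Type*} [Fintype T] [Fintype M] [Nonempty M]
    [DecidableEq M] [DecidableEq J] [Nonempty J] {V : T → Y → ℝ} (hV : ∀ t, V t ∈ stdSimplex ℝ Y)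
    (hq : q ∈ stdSimplex ℝ Y) (hK : 0 < K) {w : T → ℝ} (hw : ∀ t, 0 ≤ w t) {g : T → Y → ℝ}
    (hg : ∀ t y, 0 ≤ g t y) {c : T → Y → Y → ℝ} (hc : ∀ t y y', 0 ≤ c t y y') :
    ∃ ω : M × J → Y, ∀ h : M → J → T → ℝ, (∀ m j t, 0 ≤ h m j t) → (∀ m j t, h m j t ≤ w t) →
      (∀ m j t, h m j t ≤ g t (ω (m, j)) +
        ∑ i ∈ Finset.univ.erase (m, j), c t (ω (m, j)) (ω i)) →
      ∃ f : M → T → J, 1 / (Fintype.card M : ℝ) * ∑ m, ∑ t, h m (f m t) t ≤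
        ∑ t, (Fintype.card J / K * (∑ y, V t y * g t y +
          Fintype.card (M × J) * ∑ y, V t y * ∑ y', q y' * c t y y') +
            w t * (excessMass q (V t) K + Real.exp (-(Fintype.card J / K)))) := by
  set a : T → Y → ℝ := fun t => acceptProb q (V t) K
  have ha0 : ∀ t y, 0 ≤ a t y := fun t => acceptProb_nonneg hq.1 (hV t).1 hK
  have ha1 : ∀ t y, a t y ≤ 1 := fun t => acceptProb_le_one hq.1 hK
  set cost : M → T → (M × J → Y) → ℝ := fun m t ω => ∑ j, a t (ω (m, j)) *
    (g t (ω (m, j)) + ∑ i ∈ Finset.univ.erase (m, j), c t (ω (m, j)) (ω i)) +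
      w t * ∏ j, (1 - a t (ω (m, j)))
  set bound : T → ℝ := fun t => Fintype.card J / K * (∑ y, V t y * g t y +
    Fintype.card (M × J) * ∑ y, V t y * ∑ y', q y' * c t y y') +
      w t * (excessMass q (V t) K + Real.exp (-(Fintype.card J / K)))
  have hcost : ∀ m t, iidExp q (cost m t) ≤ bound t := fun m t =>
    iidExp_selection_le hq (hV t) hK (.sectR m J) (hg t) (hc t) (hw t)
  obtain ⟨ω, hω⟩ := exists_le_iidExp hq.1 hq.2 fun ω =>
    1 / (Fintype.card M : ℝ) * ∑ m, ∑ t, cost m t ω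
  refine ⟨ω, fun h h0 hhw hle => ?_⟩
  have hselect : ∀ m t, ∃ j, h m j t ≤ cost m t ω := fun m t => by
    obtain ⟨j, hj⟩ := exists_le_sum_mul_add_prod (fun j => a t (ω (m, j))) (fun j => h m j t)
      (w t) (fun j => ha0 t _) (fun j => ha1 t _) (fun j => h0 m j t) (fun j => hhw m j t)
    refine ⟨j, hj.trans (add_le_add_left (Finset.sum_le_sum fun j _ => ?_) _)⟩
    exact mul_le_mul_of_nonneg_left (hle m j t) (ha0 t _)
  choose f hf using hselect
  refine ⟨f, ?_⟩
  calc 1 / (Fintype.card M : ℝ) * ∑ m, ∑ t, h m (f m t) t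
      ≤ 1 / (Fintype.card M : ℝ) * ∑ m, ∑ t, cost m t ω := by
        gcongr with m _ t _
        exact hf m t
    _ ≤ 1 / (Fintype.card M : ℝ) * ∑ m, ∑ t, iidExp q (cost m t) := by
        simpa only [iidExp_sum, iidExp_mul_left] using hω
    _ ≤ 1 / (Fintype.card M : ℝ) * ∑ _m : M, ∑ t, bound t := by
        gcongr with m _ t _
        exact hcost m t
    _ = ∑ t, bound t := by
        rw [Finset.sum_const, Finset.card_univ, nsmul_eq_mul, ← mul_assoc,
          one_div_mul_cancel (Nat.cast_ne_zero.mpr Fintype.card_ne_zero), one_mul]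

end RejectionSampling

section Codebooks

/-- The encoder simulates the kernel `V` by rejection sampling from the codebook. -/
theorem exists_covering_codebook {S T J : Type*} [Fintype S] [Fintype T] [Fintype J] [Nonempty J]
    {p : S → ℝ} (hp : p ∈ stdSimplex ℝ S) {V : S → T → ℝ} (hV : ∀ s, V s ∈ stdSimplex ℝ T)
    {q : T → ℝ} (hq : q ∈ stdSimplex ℝ T) {K : ℝ} (hK : 0 < K) {h : S → T → ℝ}
    (h0 : ∀ s t, 0 ≤ h s t) (h1 : ∀ s t, h s t ≤ 1) :
    ∃ (τ : J → T) (f : S → J), ∑ s, p s * h s (τ (f s)) ≤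
      Fintype.card J / K * (∑ s, p s * ∑ t, V s t * h s t) +
        (∑ s, p s * excessMass q (V s) K + Real.exp (-(Fintype.card J / K))) := by
  classical
  have hg : ∀ s t, 0 ≤ p s * h s t := fun s t => mul_nonneg (hp.1 s) (h0 s t)
  obtain ⟨τ, hτ⟩ := exists_codebook_forall_selection (M := Unit) (J := J) hV hq hK hp.1 hg
    (c := fun _ _ _ => 0) (fun _ _ _ => le_rfl)
  obtain ⟨f, hf⟩ := hτ (fun _ k s => p s * h s (τ ((), k))) (fun _ k s => hg s _)
    (fun _ k s => mul_le_of_le_one_right (hp.1 s) (h1 s _)) (fun _ k s => by simp)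
  have hcost : ∀ s, ∑ t, V s t * (p s * h s t) = p s * ∑ t, V s t * h s t := fun s => by
    simp only [mul_left_comm _ (p s), Finset.mul_sum]
  refine ⟨fun k => τ ((), k), f (), ?_⟩
  simp only [hcost, mul_zero, Finset.sum_const_zero, add_zero, mul_add, Finset.sum_add_distrib,
    ← Finset.mul_sum, ← Finset.sum_mul, hp.2] at hf ⊢
  simpa using hf

open scoped MatrixOrder Matrix.Norms.L2Operator in
theorem exists_povm_of_tests {D κ M : Type*} [Fintype D] [DecidableEq D] [Fintype κ]
    [DecidableEq κ] [Fintype M] [Nonempty M] (π : κ → M) {Λ : κ → Matrix D D ℂ}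
    (h0 : ∀ i, 0 ≤ Λ i) (h1 : ∀ i, Λ i ≤ 1) {δ : ℝ} (hδ : 0 < δ) :
    ∃ β : M → Matrix D D ℂ, (∀ m, 0 ≤ β m) ∧ ∑ m, β m = 1 ∧ ∀ i, ∀ ρ : Matrix D D ℂ, 0 ≤ ρ →
      born (1 - β (π i)) ρ ≤ 2 * born (1 - Λ i) ρ +
        4 * (∑ i' ∈ Finset.univ.erase i, born (Λ i') ρ + δ * born 1 ρ) := by
  obtain ⟨γ, hγ0, hγ1, hγ⟩ := exists_squareRoot_measurement h0 h1 hδ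
  obtain ⟨β, hβ0, hβ1, hβ⟩ := exists_povm_of_sum_le_one π hγ0 hγ1
  refine ⟨β, hβ0, hβ1, fun i ρ hρ => ?_⟩
  have h := born_mono_left ((sub_le_sub_left (hβ i) 1).trans (hγ i)) hρ
  simpa only [map_add, map_smul, map_sum, LinearMap.add_apply, LinearMap.smul_apply,
    LinearMap.sum_apply, smul_eq_mul] using h

open scoped MatrixOrder in
/-- The encoder simulates `V` by rejection sampling among the codewords of the message, and all
codewords together are decoded by the square-root measurement. -/
theorem exists_packing_codebook {T U D M J : Type*} [Fintype T] [Fintype U] [Fintype D]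
    [DecidableEq D] [Fintype M] [Nonempty M] [Fintype J] [Nonempty J] {V : T → U → ℝ}
    (hV : ∀ t, V t ∈ stdSimplex ℝ U) {q : U → ℝ} (hq : q ∈ stdSimplex ℝ U) {K : ℝ} (hK : 0 < K)
    {σ : T → U → Matrix D D ℂ} (hσ : ∀ t u, 0 ≤ σ t u) {w : T → ℝ} (hw : w ∈ stdSimplex ℝ T)
    (hσw : ∀ t u, born 1 (σ t u) = w t) {Λ : U → Matrix D D ℂ} (h0 : ∀ u, 0 ≤ Λ u)
    (h1 : ∀ u, Λ u ≤ 1) {δ : ℝ} (hδ : 0 < δ) :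
    ∃ (ω : M × J → U) (β : M → Matrix D D ℂ) (f : M → T → J),
      (∀ m, 0 ≤ β m) ∧ ∑ m, β m = 1 ∧
      1 / (Fintype.card M : ℝ) * ∑ m, ∑ t, born (1 - β m) (σ t (ω (m, f m t))) ≤
        Fintype.card J / K * (2 * ∑ t, ∑ u, V t u * born (1 - Λ u) (σ t u) +
          4 * (Fintype.card (M × J) *
            ∑ t, ∑ u, V t u * ∑ v, q v * born (Λ v) (σ t u) + δ)) +
        (∑ t, w t * excessMass q (V t) K + Real.exp (-(Fintype.card J / K))) := by
  classical
  set g : T → U → ℝ := fun t u => 2 * born (1 - Λ u) (σ t u) + 4 * (δ * w t)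
  set c : T → U → U → ℝ := fun t u v => 4 * born (Λ v) (σ t u)
  have hg0 : ∀ t u, 0 ≤ g t u := fun t u => by
    have := born_nonneg (sub_nonneg.mpr (h1 u)) (hσ t u)
    have := mul_nonneg hδ.le (hw.1 t)
    positivity
  have hc0 : ∀ t u v, 0 ≤ c t u v := fun t u v =>
    mul_nonneg zero_le_four (born_nonneg (h0 v) (hσ t u))
  obtain ⟨ω, hω⟩ := exists_codebook_forall_selection (M := M) (J := J) hV hq hK hw.1 hg0 hc0
  obtain ⟨β, hβ, hβ1, hβΛ⟩ := exists_povm_of_tests (Prod.fst : M × J → M) (fun i => h0 (ω i))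
    (fun i => h1 (ω i)) hδ
  have hβle : ∀ m, β m ≤ 1 := fun m =>
    hβ1 ▸ Finset.single_le_sum (fun m _ => hβ m) (Finset.mem_univ m)
  obtain ⟨f, hf⟩ := hω (fun m j t => born (1 - β m) (σ t (ω (m, j))))
    (fun m j t => born_nonneg (sub_nonneg.mpr (hβle m)) (hσ _ _))
    (fun m j t => (born_mono_left (sub_le_self 1 (hβ m)) (hσ _ _)).trans_eq (hσw _ _))
    (fun m j t => (hβΛ (m, j) _ (hσ t _)).trans_eq (by
      simp only [g, c, hσw, ← Finset.mul_sum]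
      ring))
  have hsum_g : ∀ t, ∑ u, V t u * g t u =
      2 * ∑ u, V t u * born (1 - Λ u) (σ t u) + 4 * (δ * w t) := fun t => by
    simp only [g, mul_add, Finset.sum_add_distrib, ← Finset.sum_mul, (hV t).2, one_mul,
      mul_left_comm _ (2 : ℝ), Finset.mul_sum]
  refine ⟨ω, β, f, hβ, hβ1, hf.trans_eq ?_⟩
  simp only [hsum_g, c, mul_left_comm _ (4 : ℝ), ← Finset.mul_sum, mul_add,
    Finset.sum_add_distrib, ← Finset.sum_mul, hw.2]
  ring

end Codebooks

section OutputDist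

variable {A C : Type*} [Fintype A]

/-- The output distribution `∑ a, r a * V a c` of the channel `V` with input distribution `r`. -/
def outputDist (r : A → ℝ) (V : A → C → ℝ) (c : C) : ℝ := ∑ a, r a * V a c

theorem outputDist_mem_stdSimplex [Fintype C] {r : A → ℝ} {V : A → C → ℝ}
    (hr : r ∈ stdSimplex ℝ A) (hV : ∀ a, V a ∈ stdSimplex ℝ C) :
    outputDist r V ∈ stdSimplex ℝ C := by
  refine ⟨fun c => Finset.sum_nonneg fun a _ => mul_nonneg (hr.1 a) ((hV a).1 c), ?_⟩
  simp only [outputDist]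
  rw [Finset.sum_comm]
  simp only [← Finset.mul_sum, (hV _).2, mul_one, hr.2]

end OutputDist

section CQMatrix

open scoped MatrixOrder

variable {U D : Type*}

/-- The block `(⟨u| ⊗ 1) Λ (|u⟩ ⊗ 1)` of an operator on a product space. -/
def diagBlock (Λ : Matrix (U × D) (U × D) ℂ) (u : U) : Matrix D D ℂ :=
  Λ.submatrix (Prod.mk u) (Prod.mk u)

theorem diagBlock_sub (Λ Λ' : Matrix (U × D) (U × D) ℂ) (u : U) :
    diagBlock (Λ - Λ') u = diagBlock Λ u - diagBlock Λ' u := rfl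

theorem diagBlock_one [DecidableEq U] [DecidableEq D] (u : U) :
    diagBlock (1 : Matrix (U × D) (U × D) ℂ) u = 1 :=
  submatrix_one _ (Prod.mk_right_injective u)

theorem diagBlock_nonneg {Λ : Matrix (U × D) (U × D) ℂ} (hΛ : 0 ≤ Λ) (u : U) :
    0 ≤ diagBlock Λ u :=
  ((nonneg_iff_posSemidef.mp hΛ).submatrix _).nonneg

theorem diagBlock_le_one [DecidableEq U] [DecidableEq D] {Λ : Matrix (U × D) (U × D) ℂ}
    (hΛ : Λ ≤ 1) (u : U) : diagBlock Λ u ≤ 1 := by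
  have h := diagBlock_nonneg (sub_nonneg.mpr hΛ) u
  rwa [diagBlock_sub, diagBlock_one, sub_nonneg] at h

variable [Fintype U] [DecidableEq U]

/-- The classical-quantum matrix `∑ u, |u⟩⟨u| ⊗ Q u`. -/
def cqMatrix (Q : U → Matrix D D ℂ) : Matrix (U × D) (U × D) ℂ :=
  ∑ u, single u u (1 : ℂ) ⊗ₖ Q u

theorem cqMatrix_apply (Q : U → Matrix D D ℂ) (i j : U × D) :
    cqMatrix Q i j = if i.1 = j.1 then Q i.1 i.2 j.2 else 0 := by
  simp only [cqMatrix, Matrix.sum_apply, kroneckerMap_apply, single_apply, ite_mul, one_mul,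
    zero_mul, ite_and, Finset.sum_ite_eq', Finset.mem_univ, if_true]

theorem diagBlock_cqMatrix (Q : U → Matrix D D ℂ) (u : U) : diagBlock (cqMatrix Q) u = Q u := by
  ext d d'
  simp [diagBlock, cqMatrix_apply]

theorem cqMatrix_nonneg [Finite D] {Q : U → Matrix D D ℂ} (hQ : ∀ u, 0 ≤ Q u) : 0 ≤ cqMatrix Q := by
  refine Finset.sum_nonneg fun u _ => (PosSemidef.kronecker ?_ (hQ u).posSemidef).nonneg
  rw [← diagonal_single]
  exact PosSemidef.diagonal (Pi.single_nonneg.mpr zero_le_one)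

theorem cqMatrix_le_one [Finite D] [DecidableEq D] {Q : U → Matrix D D ℂ} (hQ : ∀ u, Q u ≤ 1) :
    cqMatrix Q ≤ 1 := by
  have hsub : 1 - cqMatrix Q = cqMatrix fun u => 1 - Q u := by
    ext i j
    simp only [Matrix.sub_apply, cqMatrix_apply, Matrix.one_apply, Prod.ext_iff]
    split_ifs <;> simp_all
  rw [← sub_nonneg, hsub]
  exact cqMatrix_nonneg fun u => sub_nonneg.mpr (hQ u)

theorem born_cqMatrix [Fintype D] (Λ : Matrix (U × D) (U × D) ℂ) (Q : U → Matrix D D ℂ) :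
    born Λ (cqMatrix Q) = ∑ u, born (diagBlock Λ u) (Q u) := by
  simp only [born_apply, ← Complex.re_sum]
  congr 1
  simp only [trace, Matrix.diag_apply, Matrix.mul_apply, cqMatrix_apply, Fintype.sum_prod_type,
    diagBlock, submatrix_apply, mul_ite, mul_zero, Finset.sum_ite_irrel, Finset.sum_const_zero,
    Finset.sum_ite_eq', Finset.mem_univ, if_true]

end CQMatrix

namespace AuxKernels

open scoped MatrixOrder

section Marginals

variable {X S B T U : Type*} [Fintype X] [Fintype S] [Fintype B] [Fintype T] [Fintype U] {n : ℕ}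

/-- Distribution of `S̃^n`. -/
def distT (N : ChannelSeq X S B) (P : AuxKernels X S T U n) : T → ℝ :=
  outputDist (N.stateDist n) P.pT

/-- Distribution of `U^n`. -/
def distU (N : ChannelSeq X S B) (P : AuxKernels X S T U n) : U → ℝ :=
  outputDist (P.distT N) P.pU

/-- Output state averaged over the input distribution `p(x | u, s̃)`. -/
noncomputable def outAvg (N : ChannelSeq X S B) (P : AuxKernels X S T U n) (s : Fin n → S) (t : T)
    (u : U) : Matrix (Fin n → B) (Fin n → B) ℂ :=
  ∑ x, P.pX u t x • N.out x s

/-- Output state given `s̃` and `u`, weighted by the probability of `s̃`. -/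
noncomputable def outTU (N : ChannelSeq X S B) (P : AuxKernels X S T U n) (t : T) (u : U) :
    Matrix (Fin n → B) (Fin n → B) ℂ :=
  ∑ s, (N.stateDist n s * P.pT s t) • P.outAvg N s t u

/-- Output state given `u`, weighted by the probability of `u`. -/
noncomputable def outU (N : ChannelSeq X S B) (P : AuxKernels X S T U n) (u : U) :
    Matrix (Fin n → B) (Fin n → B) ℂ :=
  ∑ t, P.pU t u • P.outTU N t u

variable (N : ChannelSeq X S B) (P : AuxKernels X S T U n)

theorem jointST_eq (s : Fin n → S) (t : T) : P.jointST N s t = N.stateDist n s * P.pT s t := by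
  simp only [jointST, joint, ← Finset.mul_sum, (P.pX_mem _ _).2, (P.pU_mem _).2, mul_one]

theorem jointUT_eq (u : U) (t : T) : P.jointUT N u t = P.distT N t * P.pU t u := by
  simp only [jointUT, joint, ← Finset.mul_sum, (P.pX_mem _ _).2, mul_one, ← Finset.sum_mul, distT,
    outputDist]

theorem distT_mem : P.distT N ∈ stdSimplex ℝ T :=
  outputDist_mem_stdSimplex (N.stateDist_mem n) P.pT_mem

theorem distU_mem : P.distU N ∈ stdSimplex ℝ U :=
  outputDist_mem_stdSimplex (P.distT_mem N) P.pU_mem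

theorem outAvg_nonneg (s : Fin n → S) (t : T) (u : U) : 0 ≤ P.outAvg N s t u :=
  Finset.sum_nonneg fun x _ => ((N.out_posSemidef x s).smul ((P.pX_mem u t).1 x)).nonneg

theorem outTU_nonneg (t : T) (u : U) : 0 ≤ P.outTU N t u :=
  Finset.sum_nonneg fun s _ => ((P.outAvg_nonneg N s t u).posSemidef.smul
    (mul_nonneg ((N.stateDist_mem n).1 s) ((P.pT_mem s).1 t))).nonneg

theorem outU_nonneg (u : U) : 0 ≤ P.outU N u :=
  Finset.sum_nonneg fun t _ =>
    ((P.outTU_nonneg N t u).posSemidef.smul ((P.pU_mem t).1 u)).nonneg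

theorem born_outTU (Λ : Matrix (Fin n → B) (Fin n → B) ℂ) (t : T) (u : U) :
    born Λ (P.outTU N t u) = ∑ s, N.stateDist n s * P.pT s t * born Λ (P.outAvg N s t u) := by
  simp only [outTU, map_sum, map_smul, smul_eq_mul]

theorem born_outU (Λ : Matrix (Fin n → B) (Fin n → B) ℂ) (u : U) :
    born Λ (P.outU N u) = ∑ t, P.pU t u * born Λ (P.outTU N t u) := by
  simp only [outU, map_sum, map_smul, smul_eq_mul]

variable [DecidableEq B]

theorem born_one_outAvg (s : Fin n → S) (t : T) (u : U) : born 1 (P.outAvg N s t u) = 1 := by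
  have hout : ∀ x, born 1 (N.out x s) = 1 := fun x => by
    rw [born_apply, Matrix.one_mul, N.out_trace, Complex.one_re]
  simp only [outAvg, map_sum, map_smul, hout, smul_eq_mul, mul_one, (P.pX_mem u t).2]

theorem born_one_outTU (t : T) (u : U) : born 1 (P.outTU N t u) = P.distT N t := by
  simp only [born_outTU, born_one_outAvg, mul_one, distT, outputDist]

theorem born_one_outU (u : U) : born 1 (P.outU N u) = P.distU N u := by
  simp only [born_outU, born_one_outTU, distU, outputDist, mul_comm]

end Marginals

section States

variable {X S B T U : Type*} [Fintype X] [DecidableEq X] [Fintype S] [DecidableEq S] [Fintype B]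
  [Fintype T] [DecidableEq T] [Fintype U] [DecidableEq U] {n : ℕ}
  (N : ChannelSeq X S B) (P : AuxKernels X S T U n)

theorem state_apply (s : Fin n → S) (t : T) (u u' : U) (x : Fin n → X) (b b' : Fin n → B) :
    P.state N (s, t, u, x, b) (s, t, u', x, b') =
      if u = u' then (P.joint N s t u x : ℂ) * N.out x s b b' else 0 := by
  simp only [state, Matrix.sum_apply, Matrix.smul_apply, kroneckerMap_apply, single_apply,
    and_self, ite_mul, one_mul, zero_mul, smul_ite, smul_zero, ite_and,
    Complex.real_smul]
  simp

theorem stateUB_eq_cqMatrix : P.stateUB N = cqMatrix (P.outU N) := by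
  ext i j
  rw [cqMatrix_apply]
  simp only [stateUB, of_apply, state_apply]
  split_ifs with h
  · simp only [outU, outTU, outAvg, Matrix.sum_apply, Matrix.smul_apply, Complex.real_smul, joint,
      Finset.mul_sum]
    rw [Finset.sum_comm]
    refine Finset.sum_congr rfl fun t _ => Finset.sum_congr rfl fun s _ =>
      Finset.sum_congr rfl fun x _ => ?_
    push_cast
    ring
  · simp

theorem stateU_eq_diagonal : P.stateU N = diagonal fun u => (P.distU N u : ℂ) := by
  classical
  ext u u'
  simp only [stateU, of_apply, stateUB_eq_cqMatrix, cqMatrix_apply, diagonal_apply]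
  split_ifs with h
  · rw [← born_one_outU, born_apply, Matrix.one_mul,
      ← Complex.eq_re_of_ofReal_le (P.outU_nonneg N u).posSemidef.trace_nonneg]
    rfl
  · simp

theorem stateB_eq_sum : P.stateB N = ∑ u, P.outU N u := by
  ext b b'
  simp [stateB, stateUB_eq_cqMatrix, cqMatrix_apply, Matrix.sum_apply]

theorem stateB_nonneg : 0 ≤ P.stateB N := by
  rw [stateB_eq_sum]
  exact Finset.sum_nonneg fun u _ => P.outU_nonneg N u

theorem stateUB_nonneg : 0 ≤ P.stateUB N :=
  P.stateUB_eq_cqMatrix N ▸ cqMatrix_nonneg (P.outU_nonneg N)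

theorem born_stateUB (Λ : Matrix (U × (Fin n → B)) (U × (Fin n → B)) ℂ) :
    born Λ (P.stateUB N) = ∑ t, ∑ u, P.pU t u * born (diagBlock Λ u) (P.outTU N t u) := by
  simp only [stateUB_eq_cqMatrix, born_cqMatrix, born_outU]
  exact Finset.sum_comm

theorem stateU_kronecker_stateB_eq_cqMatrix :
    P.stateU N ⊗ₖ P.stateB N = cqMatrix fun u => P.distU N u • P.stateB N := by
  ext i j
  rw [cqMatrix_apply, kroneckerMap_apply, stateU_eq_diagonal, diagonal_apply]
  split_ifs <;> simp

theorem stateU_kronecker_stateB_nonneg : 0 ≤ P.stateU N ⊗ₖ P.stateB N :=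
  P.stateU_kronecker_stateB_eq_cqMatrix N ▸ cqMatrix_nonneg fun u =>
    ((P.stateB_nonneg N).posSemidef.smul ((P.distU_mem N).1 u)).nonneg

theorem born_stateU_kronecker_stateB (Λ : Matrix (U × (Fin n → B)) (U × (Fin n → B)) ℂ) :
    born Λ (P.stateU N ⊗ₖ P.stateB N) =
      ∑ t, ∑ u, P.pU t u * ∑ v, P.distU N v * born (diagBlock Λ v) (P.outTU N t u) := by
  rw [stateU_kronecker_stateB_eq_cqMatrix, born_cqMatrix, stateB_eq_sum]
  simp only [map_smul, map_sum, born_outU, smul_eq_mul, Finset.mul_sum]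
  rw [Finset.sum_comm_cycle]
  refine Finset.sum_congr rfl fun t _ => Finset.sum_comm.trans ?_
  simp only [mul_left_comm]

theorem isHermitian_stateUB_sub (c : ℝ) :
    (P.stateUB N - c • (P.stateU N ⊗ₖ P.stateB N)).IsHermitian := by
  refine (P.stateUB_nonneg N).posSemidef.isHermitian.sub ?_
  rw [IsHermitian, conjTranspose_smul, star_trivial,
    (P.stateU_kronecker_stateB_nonneg N).posSemidef.isHermitian.eq]

variable [DecidableEq B]

theorem born_one_stateUB : born 1 (P.stateUB N) = 1 := by
  simp only [stateUB_eq_cqMatrix, born_cqMatrix, diagBlock_one, born_one_outU, (P.distU_mem N).2]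

theorem born_one_stateB : born 1 (P.stateB N) = 1 := by
  simp only [stateB_eq_sum, map_sum, born_one_outU, (P.distU_mem N).2]

/-- The test that compares `Θ^{UB}` with `c • Θ^U ⊗ Θ^B`. -/
noncomputable def test (c : ℝ) : Matrix (U × (Fin n → B)) (U × (Fin n → B)) ℂ :=
  nonnegProj (P.stateUB N - c • (P.stateU N ⊗ₖ P.stateB N))

theorem born_test_stateUB_le_one (c : ℝ) : born (P.test N c) (P.stateUB N) ≤ 1 :=
  (born_mono_left (nonnegProj_le_one _) (P.stateUB_nonneg N)).trans_eq (P.born_one_stateUB N)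

theorem born_test_stateU_kronecker_stateB_le {c : ℝ} (hc : 0 < c) :
    born (P.test N c) (P.stateU N ⊗ₖ P.stateB N) ≤ 1 / c := by
  have h := born_nonneg PosSemidef.one.nonneg
    (nonnegProj_mul_self_nonneg (P.isHermitian_stateUB_sub N c))
  rw [born_apply, Matrix.one_mul, ← born_apply, map_sub, map_smul, smul_eq_mul, sub_nonneg] at h
  rw [le_div_iff₀' hc]
  exact h.trans (P.born_test_stateUB_le_one N c)

theorem le_born_test_stateUB {c : ℝ} (hc : 0 ≤ c)
    {Λ : Matrix (U × (Fin n → B)) (U × (Fin n → B)) ℂ} (h0 : 0 ≤ Λ) (h1 : Λ ≤ 1) :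
    born Λ (P.stateUB N) - c * born Λ (P.stateU N ⊗ₖ P.stateB N) ≤
      born (P.test N c) (P.stateUB N) := by
  have h := born_le_born_nonnegProj (P.isHermitian_stateUB_sub N c) h0 h1
  simp only [map_sub, map_smul, smul_eq_mul] at h
  exact h.trans (sub_le_self _ (mul_nonneg hc
    (born_nonneg (nonnegProj_nonneg _) (P.stateU_kronecker_stateB_nonneg N))))

end States

end AuxKernels

section OneShot

open scoped MatrixOrder

variable {X S B T U : Type*} [Fintype X] [Fintype S] [Fintype B] [DecidableEq B] [Fintype T]
  [Fintype U] {n : ℕ}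

theorem Code.error_eq (C : Code X S B n) (N : ChannelSeq X S B) :
    C.error N = 1 / (C.M : ℝ) * ∑ m, ∑ s, N.stateDist n s *
      born (1 - C.povm m) (∑ x, C.enc m (C.stateEnc s) x • N.out x s) := by
  simp only [Code.error, map_sum, map_smul, smul_eq_mul, born_apply]

/-- The codeword for message `m` may depend on `s̃`. -/
theorem exists_code_of_povm (N : ChannelSeq X S B) (P : AuxKernels X S T U n) {K : ℝ} (hK : 0 < K)
    {M Me : ℕ} (hM : 0 < M) (hMe : 0 < Me) (u : Fin M → T → U)
    {β : Fin M → Matrix (Fin n → B) (Fin n → B) ℂ} (hβ : ∀ m, 0 ≤ β m) (hβ1 : ∑ m, β m = 1) :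
    ∃ C : Code X S B n, C.M = M ∧ C.Me = Me ∧ C.error N ≤
      Me / K * (1 / M * ∑ m, ∑ t, born (1 - β m) (P.outTU N t (u m t))) +
        (∑ s, N.stateDist n s * excessMass (P.distT N) (P.pT s) K + Real.exp (-(Me / K))) := by
  have : Nonempty (Fin Me) := ⟨⟨0, hMe⟩⟩
  set err : Fin M → (Fin n → S) → T → ℝ := fun m s t => born (1 - β m) (P.outAvg N s t (u m t))
  have hβle : ∀ m, β m ≤ 1 := fun m =>
    hβ1 ▸ Finset.single_le_sum (fun m _ => hβ m) (Finset.mem_univ m)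
  have herr0 : ∀ m s t, 0 ≤ err m s t := fun m s t =>
    born_nonneg (sub_nonneg.mpr (hβle m)) (P.outAvg_nonneg N _ _ _)
  have herr1 : ∀ m s t, err m s t ≤ 1 := fun m s t =>
    (born_mono_left (sub_le_self 1 (hβ m)) (P.outAvg_nonneg N _ _ _)).trans_eq
      (P.born_one_outAvg N _ _ _)
  obtain ⟨τ, f, hcov⟩ := exists_covering_codebook (J := Fin Me) (N.stateDist_mem n) P.pT_mem
    (P.distT_mem N) hK (h := fun s t => 1 / (M : ℝ) * ∑ m, err m s t)
    (fun s t => mul_nonneg (by positivity) (Finset.sum_nonneg fun m _ => herr0 m s t))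
    (fun s t => by
      rw [one_div, inv_mul_le_iff₀ (Nat.cast_pos.mpr hM), mul_one]
      simpa using Finset.sum_le_card_nsmul Finset.univ _ 1 fun m _ => herr1 m s t)
  refine ⟨⟨M, hM, Me, hMe, f, fun m k => P.pX (u m (τ k)) (τ k), fun m k => P.pX_mem _ _, β,
    fun m => (hβ m).posSemidef, hβ1⟩, rfl, rfl, ?_⟩
  rw [Fintype.card_fin] at hcov
  have herror : ∑ s, N.stateDist n s * (1 / (M : ℝ) * ∑ m, err m s (τ (f s))) =
      1 / (M : ℝ) * ∑ m, ∑ s, N.stateDist n s * err m s (τ (f s)) := by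
    simp only [mul_left_comm _ (1 / (M : ℝ)), ← Finset.mul_sum]
    simp only [Finset.mul_sum]
    rw [Finset.sum_comm]
  have haverage : ∑ s, N.stateDist n s * ∑ t, P.pT s t * (1 / (M : ℝ) * ∑ m, err m s t) =
      1 / (M : ℝ) * ∑ m, ∑ t, born (1 - β m) (P.outTU N t (u m t)) := by
    simp only [P.born_outTU N, mul_left_comm _ (1 / (M : ℝ)), ← Finset.mul_sum]
    simp only [Finset.mul_sum, mul_assoc]
    rw [Finset.sum_comm_cycle]
    simp only [Finset.sum_comm (s := (Finset.univ : Finset T))]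
    rfl
  rw [Code.error_eq]
  rw [herror, haverage] at hcov
  exact hcov

theorem exists_code [DecidableEq X] [DecidableEq S] [DecidableEq T] [DecidableEq U]
    (N : ChannelSeq X S B) (P : AuxKernels X S T U n) {KU KT c : ℝ} (hKU : 0 < KU) (hKT : 0 < KT)
    (hc : 0 < c) {M J Me : ℕ} (hM : 0 < M) (hJ : 0 < J) (hMe : 0 < Me) :
    ∃ C : Code X S B n, C.M = M ∧ C.Me = Me ∧ C.error N ≤
      Me / KT * (J / KU * (2 * (1 - born (P.test N c) (P.stateUB N)) + 8 * (M * J / c)) +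
        (∑ t, P.distT N t * excessMass (P.distU N) (P.pU t) KU + Real.exp (-(J / KU)))) +
      (∑ s, N.stateDist n s * excessMass (P.distT N) (P.pT s) KT + Real.exp (-(Me / KT))) := by
  have : Nonempty (Fin M) := ⟨⟨0, hM⟩⟩
  have : Nonempty (Fin J) := ⟨⟨0, hJ⟩⟩
  have hδ : (0 : ℝ) < M * J / c := by positivity
  obtain ⟨ω, β, f, hβ, hβ1, hpack⟩ := exists_packing_codebook (M := Fin M) (J := Fin J) P.pU_mem
    (P.distU_mem N) hKU (P.outTU_nonneg N) (P.distT_mem N) (P.born_one_outTU N)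
    (diagBlock_nonneg (nonnegProj_nonneg _)) (diagBlock_le_one (nonnegProj_le_one _))
    (Λ := diagBlock (P.test N c)) hδ
  obtain ⟨C, hCM, hCMe, hC⟩ := exists_code_of_povm N P hKT hM hMe (fun m t => ω (m, f m t)) hβ hβ1
  have hdetect : ∑ t, ∑ u, P.pU t u * born (1 - diagBlock (P.test N c) u) (P.outTU N t u) =
      1 - born (P.test N c) (P.stateUB N) := by
    have hblock : ∀ u, 1 - diagBlock (P.test N c) u = diagBlock (1 - P.test N c) u := fun u => by
      rw [diagBlock_sub, diagBlock_one]
    simp only [hblock]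
    rw [← P.born_stateUB N, map_sub, LinearMap.sub_apply, P.born_one_stateUB]
  have hconfuse := P.born_test_stateU_kronecker_stateB_le N hc
  rw [hdetect, ← P.born_stateU_kronecker_stateB N, Fintype.card_prod, Fintype.card_fin,
    Fintype.card_fin, Nat.cast_mul] at hpack
  refine ⟨C, hCM, hCMe, hC.trans ?_⟩
  gcongr
  refine hpack.trans ?_
  gcongr ?_ * (_ + ?_) + _
  calc 4 * (M * J * born (P.test N c) (P.stateU N ⊗ₖ P.stateB N) + M * J / c)
      ≤ 4 * (M * J * (1 / c) + M * J / c) := by gcongr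
    _ = 8 * (M * J / c) := by ring

end OneShot

section InfoDensity

variable {A C : Type*} [Fintype A] [Fintype C] {r : A → ℝ} {V : A → C → ℝ} {K : ℝ}

theorem probInfoDensityGT_mul (hr : ∀ a, 0 ≤ r a) (hV : ∀ a, V a ∈ stdSimplex ℝ C) {n : ℕ}
    (hn : 0 < n) (x : ℝ) :
    probInfoDensityGT n (fun a c => r a * V a c) x =
      ∑ a, r a * excessMass (outputDist r V) (V a) ((2 : ℝ) ^ ((n : ℝ) * x)) := by
  have hfst : ∀ a, marginalFst (fun a c => r a * V a c) a = r a := fun a => by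
    rw [marginalFst, ← Finset.mul_sum, (hV a).2, mul_one]
  have hsnd : ∀ c, marginalSnd (fun a c => r a * V a c) c = outputDist r V c := fun c => rfl
  simp only [probInfoDensityGT, excessMass, Finset.mul_sum, mul_ite, mul_zero, hfst, hsnd]
  refine Finset.sum_congr rfl fun a _ => Finset.sum_congr rfl fun c _ => ?_
  rcases (hr a).eq_or_lt with hra | hra
  · simp [← hra]
  rcases ((hV a).1 c).eq_or_lt with hVac | hVac
  · simp [← hVac]
  have hout : 0 < outputDist r V c := (mul_pos hra hVac).trans_le <|
    Finset.single_le_sum (f := fun a => r a * V a c)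
      (fun a _ => mul_nonneg (hr a) ((hV a).1 c)) (Finset.mem_univ a)
  have hn' : (0 : ℝ) < n := Nat.cast_pos.mpr hn
  simp only [mul_div_mul_left _ _ hra.ne', one_div, lt_inv_mul_iff₀ hn',
    Real.lt_logb_iff_rpow_lt one_lt_two (div_pos hVac hout), lt_div_iff₀ hout]

theorem probInfoDensityGT_swap (n : ℕ) (p : A → C → ℝ) (x : ℝ) :
    probInfoDensityGT n (fun c a => p a c) x = probInfoDensityGT n p x := by
  rw [probInfoDensityGT, probInfoDensityGT, Finset.sum_comm]
  simp only [mul_comm (marginalFst (fun c a => p a c) _)]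
  rfl

theorem one_sub_le_sum_mul_excessMass (hr : r ∈ stdSimplex ℝ A)
    (hV : ∀ a, V a ∈ stdSimplex ℝ C) (hK : 0 ≤ K) :
    1 - K ≤ ∑ a, r a * excessMass (outputDist r V) (V a) K := by
  have hq := outputDist_mem_stdSimplex hr hV
  have hexcess : ∀ a, 1 - K ≤ excessMass (outputDist r V) (V a) K := fun a =>
    calc 1 - K = ∑ c, (V a c - K * outputDist r V c) := by
          rw [Finset.sum_sub_distrib, (hV a).2, ← Finset.mul_sum, hq.2, mul_one]
      _ ≤ excessMass (outputDist r V) (V a) K := Finset.sum_le_sum fun c _ => by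
          split_ifs with h
          · exact sub_le_self _ (mul_nonneg hK (hq.1 c))
          · exact sub_nonpos.mpr (not_lt.mp h)
  calc 1 - K = ∑ a, r a * (1 - K) := by rw [← Finset.sum_mul, hr.2, one_mul]
    _ ≤ _ := Finset.sum_le_sum fun a _ => mul_le_mul_of_nonneg_left (hexcess a) (hr.1 a)

theorem sum_mul_excessMass_le_card_div (hr : r ∈ stdSimplex ℝ A)
    (hV : ∀ a, V a ∈ stdSimplex ℝ C) (hK : 0 < K) :
    ∑ a, r a * excessMass (outputDist r V) (V a) K ≤ Fintype.card C / K := by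
  classical
  have hletter : ∀ c, ∑ a, r a * (if K * outputDist r V c < V a c then V a c else 0) ≤ 1 / K := by
    intro c
    rcases le_or_gt (K * outputDist r V c) 1 with h | h
    · refine le_trans ?_ ((le_div_iff₀' hK).mpr h)
      refine Finset.sum_le_sum fun a _ => mul_le_mul_of_nonneg_left ?_ (hr.1 a)
      split_ifs
      exacts [le_rfl, (hV a).1 c]
    · have hle : ∀ a, ¬ K * outputDist r V c < V a c := fun a =>
        not_lt.mpr ((mem_Icc_of_mem_stdSimplex (hV a) c).2.trans h.le)
      simp only [hle, if_false, mul_zero, Finset.sum_const_zero]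
      positivity
  calc ∑ a, r a * excessMass (outputDist r V) (V a) K
      = ∑ c, ∑ a, r a * (if K * outputDist r V c < V a c then V a c else 0) := by
        simp only [excessMass, Finset.mul_sum]
        exact Finset.sum_comm
    _ ≤ Fintype.card C / K := by
        simpa [div_eq_mul_inv] using Finset.sum_le_card_nsmul Finset.univ _ _ fun c _ => hletter c

end InfoDensity

theorem tendsto_two_rpow_mul {x : ℝ} (hx : x < 0) :
    Tendsto (fun n : ℕ => (2 : ℝ) ^ ((n : ℝ) * x)) atTop (𝓝 0) := by
  simp only [mul_comm _ x, Real.rpow_mul two_pos.le, Real.rpow_natCast]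
  exact tendsto_pow_atTop_nhds_zero_of_lt_one (by positivity)
    (Real.rpow_lt_one_of_one_lt_of_neg one_lt_two hx)

theorem nonneg_of_tendsto_of_one_sub_rpow_le {F : ℕ → ℝ → ℝ}
    (hF : ∀ n : ℕ, 0 < n → ∀ x, 1 - (2 : ℝ) ^ ((n : ℝ) * x) ≤ F n x) {x : ℝ}
    (h : ∀ γ : ℝ, 0 < γ → Tendsto (fun n => F n (x + γ)) atTop (𝓝 0)) : 0 ≤ x := by
  by_contra! hx
  have hlower : Tendsto (fun n : ℕ => 1 - (2 : ℝ) ^ ((n : ℝ) * (x + -x / 2))) atTop (𝓝 (1 - 0)) :=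
    (tendsto_two_rpow_mul (by linarith)).const_sub 1
  have := le_of_tendsto_of_tendsto hlower (h (-x / 2) (by linarith))
    ((eventually_gt_atTop 0).mono fun n hn => hF n hn _)
  linarith

namespace AuxKernels

variable {X S B T U : Type*} [Fintype X] [Fintype S] [Fintype B] [Fintype T] [Fintype U] {n : ℕ}
  (N : ChannelSeq X S B) (P : AuxKernels X S T U n)

theorem probInfoDensityGT_jointST (hn : 0 < n) (x : ℝ) :
    probInfoDensityGT n (P.jointST N) x = ∑ s, N.stateDist n s *
      excessMass (P.distT N) (P.pT s) ((2 : ℝ) ^ ((n : ℝ) * x)) := by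
  rw [distT, ← probInfoDensityGT_mul (N.stateDist_mem n).1 P.pT_mem hn]
  simp only [← P.jointST_eq N]

theorem probInfoDensityGT_jointUT (hn : 0 < n) (x : ℝ) :
    probInfoDensityGT n (P.jointUT N) x = ∑ t, P.distT N t *
      excessMass (P.distU N) (P.pU t) ((2 : ℝ) ^ ((n : ℝ) * x)) := by
  rw [distU, ← probInfoDensityGT_mul (P.distT_mem N).1 P.pU_mem hn, ← probInfoDensityGT_swap]
  simp only [← P.jointUT_eq N]

theorem one_sub_le_probInfoDensityGT_jointST (hn : 0 < n) (x : ℝ) :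
    1 - (2 : ℝ) ^ ((n : ℝ) * x) ≤ probInfoDensityGT n (P.jointST N) x := by
  rw [probInfoDensityGT_jointST N P hn]
  exact one_sub_le_sum_mul_excessMass (N.stateDist_mem n) P.pT_mem (by positivity)

theorem one_sub_le_probInfoDensityGT_jointUT (hn : 0 < n) (x : ℝ) :
    1 - (2 : ℝ) ^ ((n : ℝ) * x) ≤ probInfoDensityGT n (P.jointUT N) x := by
  rw [probInfoDensityGT_jointUT N P hn]
  exact one_sub_le_sum_mul_excessMass (P.distT_mem N) P.pU_mem (by positivity)

theorem probInfoDensityGT_jointST_nonneg (hn : 0 < n) (x : ℝ) :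
    0 ≤ probInfoDensityGT n (P.jointST N) x := by
  rw [probInfoDensityGT_jointST N P hn]
  exact Finset.sum_nonneg fun s _ =>
    mul_nonneg ((N.stateDist_mem n).1 s) (excessMass_nonneg (P.pT_mem s).1)

theorem probInfoDensityGT_jointUT_nonneg (hn : 0 < n) (x : ℝ) :
    0 ≤ probInfoDensityGT n (P.jointUT N) x := by
  rw [probInfoDensityGT_jointUT N P hn]
  exact Finset.sum_nonneg fun t _ =>
    mul_nonneg ((P.distT_mem N).1 t) (excessMass_nonneg (P.pU_mem t).1)

theorem probInfoDensityGT_jointST_le (hn : 0 < n) (x : ℝ) :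
    probInfoDensityGT n (P.jointST N) x ≤ Fintype.card T * (2 : ℝ) ^ ((n : ℝ) * -x) := by
  rw [probInfoDensityGT_jointST N P hn, mul_neg, Real.rpow_neg two_pos.le, ← div_eq_mul_inv]
  exact sum_mul_excessMass_le_card_div (N.stateDist_mem n) P.pT_mem (by positivity)

end AuxKernels

section CapacityRegion

variable {X S B : Type*} [Fintype X] [Fintype B] [DecidableEq B]

namespace Code

variable {n : ℕ}

theorem nonempty_alphabet (hn : 0 < n) (C : Code X S B n) : Nonempty X := by
  have : Nonempty (Fin n) := ⟨⟨0, hn⟩⟩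
  by_contra! hX
  exact one_ne_zero ((C.enc_mem ⟨0, C.M_pos⟩ ⟨0, C.Me_pos⟩).2.symm.trans (Fintype.sum_empty _))

theorem nonempty_of_nonempty_alphabet [Nonempty X] : Nonempty (Code X S B n) := by
  classical
  exact ⟨{
    M := 1
    M_pos := one_pos
    Me := 1
    Me_pos := one_pos
    stateEnc := fun _ => 0
    enc := fun _ _ => Pi.single (fun _ => Classical.arbitrary X) 1
    enc_mem := fun _ _ => single_mem_stdSimplex ℝ _
    povm := fun _ => 1
    povm_posSemidef := fun _ => PosSemidef.one
    povm_sum := by simp }⟩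

end Code

theorem exists_code_seq {Q : ∀ n, Code X S B n → Prop} (h : ∀ᶠ n in atTop, ∃ C, Q n C) :
    ∃ C : ∀ n, Code X S B n, ∀ᶠ n in atTop, Q n (C n) := by
  obtain ⟨n₁, ⟨C₁, -⟩, hn₁⟩ := (h.and (eventually_gt_atTop 0)).exists
  have : Nonempty X := C₁.nonempty_alphabet hn₁
  have (n : ℕ) : Nonempty (Code X S B n) := Code.nonempty_of_nonempty_alphabet
  have hchoice : ∀ n, ∃ C, (∃ C', Q n C') → Q n C := fun n => by
    by_cases hn : ∃ C', Q n C'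
    exacts [hn.imp fun C hC _ => hC, ⟨Classical.arbitrary _, fun h => absurd h hn⟩]
  choose C hC using hchoice
  exact ⟨C, h.mono hC⟩

variable [Fintype S] {N : ChannelSeq X S B}

namespace Code

variable {n : ℕ} {C : Code X S B n} {ε ε' R R' RS RS' : ℝ}

/-- A code with error probability at most `ε`, message rate at least `R` and state-encoding rate
at most `RS`. -/
def Attains (C : Code X S B n) (N : ChannelSeq X S B) (ε R RS : ℝ) : Prop :=
  C.error N ≤ ε ∧ R ≤ 1 / (n : ℝ) * Real.logb 2 C.M ∧ 1 / (n : ℝ) * Real.logb 2 C.Me ≤ RS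

theorem attains_iff (hn : 0 < n) :
    C.Attains N ε R RS ↔ C.error N ≤ ε ∧ (2 : ℝ) ^ ((n : ℝ) * R) ≤ C.M ∧
      (C.Me : ℝ) ≤ (2 : ℝ) ^ ((n : ℝ) * RS) := by
  have hn' : (0 : ℝ) < n := Nat.cast_pos.mpr hn
  rw [Attains, one_div, le_inv_mul_iff₀ hn', inv_mul_le_iff₀ hn',
    Real.le_logb_iff_rpow_le one_lt_two (Nat.cast_pos.mpr C.M_pos),
    Real.logb_le_iff_le_rpow one_lt_two (Nat.cast_pos.mpr C.Me_pos)]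

theorem Attains.mono (h : C.Attains N ε R RS) (hε : ε ≤ ε') (hR : R' ≤ R) (hRS : RS ≤ RS') :
    C.Attains N ε' R' RS' :=
  ⟨h.1.trans hε, hR.trans h.2.1, h.2.2.trans hRS⟩

end Code

variable {R R' RS RS' : ℝ}

theorem Achievable.eventually_exists_attains (h : Achievable N R RS) {ε : ℝ} (hε : 0 < ε) :
    ∀ᶠ n in atTop, ∃ C : Code X S B n, C.Attains N ε R RS := by
  obtain ⟨C, e, herror, hM, he, hMe⟩ := h ε hε
  filter_upwards [eventually_lt_of_lt_liminf hM (by isBoundedDefault),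
    eventually_lt_of_limsup_lt he (by isBoundedDefault),
    eventually_lt_of_limsup_lt hMe (by isBoundedDefault)] with n hMn hen hMen
  exact ⟨C n, (herror n).trans (EReal.coe_lt_coe_iff.mp hen).le, (EReal.coe_lt_coe_iff.mp hMn).le,
    (EReal.coe_lt_coe_iff.mp hMen).le⟩

theorem achievable_of_eventually_exists_attains (hR : R < R') (hRS : RS' < RS)
    (h : ∀ ε, 0 < ε → ∀ᶠ n in atTop, ∃ C : Code X S B n, C.Attains N ε R' RS') :
    Achievable N R RS := by
  intro ε hε
  obtain ⟨C, hC⟩ := exists_code_seq (h (ε / 2) (half_pos hε))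
  refine ⟨C, fun n => (C n).error N, fun n => le_rfl, ?_, ?_, ?_⟩
  · exact (EReal.coe_lt_coe_iff.mpr hR).trans_le <| le_liminf_of_le (by isBoundedDefault)
      (hC.mono fun n hn => EReal.coe_le_coe_iff.mpr hn.2.1)
  · exact (limsup_le_of_le (by isBoundedDefault)
      (hC.mono fun n hn => EReal.coe_le_coe_iff.mpr hn.1)).trans_lt
      (EReal.coe_lt_coe_iff.mpr (half_lt_self hε))
  · exact (limsup_le_of_le (by isBoundedDefault)
      (hC.mono fun n hn => EReal.coe_le_coe_iff.mpr hn.2.2)).trans_lt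
      (EReal.coe_lt_coe_iff.mpr hRS)

theorem mem_capacityRegion_iff {r : ℝ × ℝ} :
    r ∈ capacityRegion N ↔ ∀ δ, 0 < δ →
      ∀ᶠ n in atTop, ∃ C : Code X S B n, C.Attains N δ (r.1 - δ) (r.2 + δ) := by
  constructor
  · intro hr δ hδ
    obtain ⟨r', hr', hdist⟩ := Metric.mem_closure_iff.mp hr δ hδ
    rw [Prod.dist_eq, max_lt_iff, Real.dist_eq, Real.dist_eq, abs_lt, abs_lt] at hdist
    filter_upwards [hr'.eventually_exists_attains hδ] with n ⟨C, hC⟩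
    exact ⟨C, hC.mono le_rfl (by linarith [hdist.1.2]) (by linarith [hdist.2.1])⟩
  · intro h
    have hachievable : ∀ δ, 0 < δ → Achievable N (r.1 - δ) (r.2 + δ) := fun δ hδ =>
      achievable_of_eventually_exists_attains (R' := r.1 - δ / 2) (RS' := r.2 + δ / 2)
        (by linarith) (by linarith) fun ε hε => by
          filter_upwards [h (min (δ / 2) ε) (lt_min (half_pos hδ) hε)] with n ⟨C, hC⟩
          exact ⟨C, hC.mono (min_le_right _ _) (sub_le_sub_left (min_le_left _ _) _)
            (add_le_add_right (min_le_left _ _) _)⟩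
    have hlim : Tendsto (fun n : ℕ => (r.1 - 1 / ((n : ℝ) + 1), r.2 + 1 / ((n : ℝ) + 1))) atTop
        (𝓝 (r.1 - 0, r.2 + 0)) :=
      (tendsto_one_div_add_atTop_nhds_zero_nat.const_sub _).prodMk_nhds
        (tendsto_one_div_add_atTop_nhds_zero_nat.const_add _)
    rw [sub_zero, add_zero] at hlim
    exact mem_closure_of_tendsto hlim
      (Eventually.of_forall fun n => hachievable _ (by positivity))

end CapacityRegion

section Direct

theorem natCeil_mul_div_le {L y : ℝ} (hL : 0 ≤ L) (hy : 1 ≤ y) : (⌈L * y⌉₊ : ℝ) / y ≤ L + 1 := by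
  rw [div_le_iff₀ (by positivity)]
  linarith [Nat.ceil_lt_add_one (show 0 ≤ L * y by positivity)]

theorem le_natCeil_mul_div {L y : ℝ} (hy : 0 < y) : L ≤ ⌈L * y⌉₊ / y :=
  (le_div_iff₀ hy).mpr (Nat.le_ceil _)

theorem natCeil_two_rpow_mul_natCeil_div_le (n : ℕ) {a b R L : ℝ} (hb : 0 ≤ b) (hR : 0 ≤ R)
    (hL : 0 ≤ L) :
    (⌈1 * (2 : ℝ) ^ ((n : ℝ) * R)⌉₊ : ℝ) * ⌈L * (2 : ℝ) ^ ((n : ℝ) * b)⌉₊ /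
      (2 : ℝ) ^ ((n : ℝ) * a) ≤ 2 * (L + 1) * (2 : ℝ) ^ ((n : ℝ) * (R + b - a)) := by
  have hone : ∀ x : ℝ, 0 ≤ x → (1 : ℝ) ≤ (2 : ℝ) ^ ((n : ℝ) * x) := fun x hx =>
    Real.one_le_rpow one_le_two (by positivity)
  have hMR := natCeil_mul_div_le zero_le_one (hone R hR)
  have hJb := natCeil_mul_div_le hL (hone b hb)
  rw [div_le_iff₀ (by positivity)] at hMR hJb
  calc _ ≤ (1 + 1) * (2 : ℝ) ^ ((n : ℝ) * R) * ((L + 1) * (2 : ℝ) ^ ((n : ℝ) * b)) /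
          (2 : ℝ) ^ ((n : ℝ) * a) := by gcongr
    _ = _ := by
      rw [mul_sub, mul_add (n : ℝ), Real.rpow_sub two_pos, Real.rpow_add two_pos]
      ring

theorem eventually_mul_two_rpow_le (K : ℝ) {c c' : ℝ} (h : c < c') :
    ∀ᶠ n : ℕ in atTop, K * (2 : ℝ) ^ ((n : ℝ) * c) ≤ (2 : ℝ) ^ ((n : ℝ) * c') := by
  have hlim := (tendsto_two_rpow_mul (sub_neg.mpr h)).const_mul K
  rw [mul_zero] at hlim
  filter_upwards [hlim.eventually_le_const one_pos] with n hn
  rwa [mul_sub, Real.rpow_sub two_pos, mul_div_assoc', div_le_one (by positivity)] at hn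

theorem exists_add_two_mul_exp_neg_lt {ε : ℝ} (hε : 0 < ε) :
    ∃ L : ℝ, 0 < L ∧ (L + 2) * Real.exp (-L) < ε := by
  have hlim : Tendsto (fun L : ℝ => L ^ 1 * Real.exp (-L) + 2 * Real.exp (-L)) atTop
      (𝓝 (0 + 2 * 0)) :=
    (Real.tendsto_pow_mul_exp_neg_atTop_nhds_zero 1).add
      (Real.tendsto_exp_neg_atTop_nhds_zero.const_mul 2)
  obtain ⟨L, hL, hL0⟩ :=
    ((hlim.eventually_lt_const (by simpa using hε)).and (eventually_gt_atTop 0)).exists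
  exact ⟨L, hL0, by rwa [pow_one, ← add_mul] at hL⟩

theorem Code.error_eq_zero_of_M_eq_one {X S B : Type*} [Fintype X] [Fintype S] [Fintype B]
    [DecidableEq B] {n : ℕ} (C : Code X S B n) (N : ChannelSeq X S B) (h : C.M = 1) :
    C.error N = 0 := by
  have : Subsingleton (Fin C.M) := by rw [h]; infer_instance
  have hpovm : ∀ m, C.povm m = 1 := fun m => by
    rw [← C.povm_sum, Fintype.sum_subsingleton _ m]
  simp [Code.error, hpovm]

section Blocklength

variable {X S B T U : Type*} [Fintype X] [Fintype S] [Fintype B] [DecidableEq B] [Fintype T]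
  [Fintype U] {n : ℕ}

theorem exists_code_attains_zero (N : ChannelSeq X S B) (P : AuxKernels X S T U n) :
    ∃ C : Code X S B n, C.Attains N 0 0 0 := by
  classical
  obtain ⟨C, hM, hMe, -⟩ := exists_code N P one_pos one_pos one_pos one_pos one_pos one_pos
  exact ⟨C, (C.error_eq_zero_of_M_eq_one N hM).le, by simp [hM], by simp [hMe]⟩

theorem exists_code_of_rates [DecidableEq X] [DecidableEq S] [DecidableEq T] [DecidableEq U]
    (hn : 0 < n) (N : ChannelSeq X S B) (P : AuxKernels X S T U n)
    {a b c R L : ℝ} (hb : 0 ≤ b) (hc : 0 ≤ c) (hR : 0 ≤ R) (hL : 0 < L) :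
    ∃ C : Code X S B n, (2 : ℝ) ^ ((n : ℝ) * R) ≤ C.M ∧
      (C.Me : ℝ) ≤ (L + 1) * (2 : ℝ) ^ ((n : ℝ) * c) ∧
      C.error N ≤ (L + 1) * ((L + 1) * (2 * (1 - born (P.test N ((2 : ℝ) ^ ((n : ℝ) * a)))
          (P.stateUB N)) + 16 * (L + 1) * (2 : ℝ) ^ ((n : ℝ) * (R + b - a))) +
        (probInfoDensityGT n (P.jointUT N) b + Real.exp (-L))) +
        (probInfoDensityGT n (P.jointST N) c + Real.exp (-L)) := by
  have hpos : ∀ x : ℝ, (0 : ℝ) < (2 : ℝ) ^ ((n : ℝ) * x) := fun x => by positivity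
  have hone : ∀ x : ℝ, 0 ≤ x → (1 : ℝ) ≤ (2 : ℝ) ^ ((n : ℝ) * x) := fun x hx =>
    Real.one_le_rpow one_le_two (by positivity)
  obtain ⟨C, hM, hMe, herror⟩ := exists_code N P (hpos b) (hpos c) (hpos a)
    (M := ⌈1 * (2 : ℝ) ^ ((n : ℝ) * R)⌉₊) (J := ⌈L * (2 : ℝ) ^ ((n : ℝ) * b)⌉₊)
    (Me := ⌈L * (2 : ℝ) ^ ((n : ℝ) * c)⌉₊) (by positivity) (by positivity) (by positivity)
  have hJb := natCeil_mul_div_le hL.le (hone b hb)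
  have hMec := natCeil_mul_div_le hL.le (hone c hc)
  refine ⟨C, ?_, ?_, herror.trans ?_⟩
  · rw [hM, one_mul]
    exact Nat.le_ceil _
  · rwa [hMe, ← div_le_iff₀ (hpos c)]
  · have hmiss := sub_nonneg.mpr (P.born_test_stateUB_le_one N ((2 : ℝ) ^ ((n : ℝ) * a)))
    have hexcess := P.probInfoDensityGT_jointUT_nonneg N hn b
    have hcodewords := natCeil_two_rpow_mul_natCeil_div_le n (a := a) hb hR hL.le
    rw [← P.probInfoDensityGT_jointUT N hn, ← P.probInfoDensityGT_jointST N hn]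
    gcongr ?_ * (?_ * (_ + ?_) + (_ + Real.exp (-?_))) + (_ + Real.exp (-?_))
    · linarith [hcodewords]
    · exact le_natCeil_mul_div (hpos b)
    · exact le_natCeil_mul_div (hpos c)

end Blocklength

variable {X S B : Type*} [Fintype X] [DecidableEq X] [Fintype S] [DecidableEq S] [Fintype B]
  [DecidableEq B] {T U : ℕ → Type*} [∀ n, Fintype (T n)] [∀ n, DecidableEq (T n)]
  [∀ n, Fintype (U n)] [∀ n, DecidableEq (U n)] {N : ChannelSeq X S B}
  {P : ∀ n, AuxKernels X S (T n) (U n) n} {a b c R RS ε : ℝ}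

theorem eventually_exists_code_attains
    (hUB : Tendsto (fun n : ℕ => born ((P n).test N ((2 : ℝ) ^ ((n : ℝ) * a))) ((P n).stateUB N))
      atTop (𝓝 1))
    (hUT : Tendsto (fun n => probInfoDensityGT n ((P n).jointUT N) b) atTop (𝓝 0))
    (hST : Tendsto (fun n => probInfoDensityGT n ((P n).jointST N) c) atTop (𝓝 0))
    (hb : 0 ≤ b) (hc : 0 ≤ c) (hR : 0 ≤ R) (hRab : R + b < a) (hcRS : c < RS) (hε : 0 < ε) :
    ∀ᶠ n in atTop, ∃ C : Code X S B n, C.Attains N ε R RS := by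
  obtain ⟨L, hL, hLε⟩ := exists_add_two_mul_exp_neg_lt hε
  have hbound := ((((hUB.const_sub 1).const_mul 2).add
    ((tendsto_two_rpow_mul (sub_neg.mpr hRab)).const_mul (16 * (L + 1)))).const_mul (L + 1)).add
    (hUT.add_const (Real.exp (-L)))
  have hlim := (hbound.const_mul (L + 1)).add (hST.add_const (Real.exp (-L)))
  filter_upwards [hlim.eventually_le_const (u := ε) (by linarith),
    eventually_mul_two_rpow_le (L + 1) hcRS, eventually_gt_atTop 0] with n hnε hnRS hn
  obtain ⟨C, hM, hMe, herror⟩ := exists_code_of_rates hn N (P n) (a := a) hb hc hR hL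
  exact ⟨C, (Code.attains_iff hn).mpr ⟨herror.trans hnε, hM, hMe.trans hnRS⟩⟩

theorem eventually_exists_code_attains_of_spectral
    (hUB : ∀ γ, 0 < γ → Tendsto (fun n : ℕ =>
      born ((P n).test N ((2 : ℝ) ^ ((n : ℝ) * (a - γ)))) ((P n).stateUB N)) atTop (𝓝 1))
    (hUT : ∀ γ, 0 < γ →
      Tendsto (fun n => probInfoDensityGT n ((P n).jointUT N) (b + γ)) atTop (𝓝 0))
    (hST : ∀ γ, 0 < γ →
      Tendsto (fun n => probInfoDensityGT n ((P n).jointST N) (c + γ)) atTop (𝓝 0))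
    (hR : R < a - b) (hRS : c < RS) (hε : 0 < ε) :
    ∀ᶠ n in atTop, ∃ C : Code X S B n, C.Attains N ε R RS := by
  have hb : 0 ≤ b := nonneg_of_tendsto_of_one_sub_rpow_le
    (fun n hn => (P n).one_sub_le_probInfoDensityGT_jointUT N hn) hUT
  have hc : 0 ≤ c := nonneg_of_tendsto_of_one_sub_rpow_le
    (fun n hn => (P n).one_sub_le_probInfoDensityGT_jointST N hn) hST
  rcases lt_or_ge R 0 with hR0 | hR0
  · refine Eventually.of_forall fun n => ?_
    obtain ⟨C, hC⟩ := exists_code_attains_zero N (P n)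
    exact ⟨C, hC.mono hε.le hR0.le (hc.trans hRS.le)⟩
  · obtain ⟨γ, hγ, hγlt⟩ := exists_between (lt_min (sub_pos.mpr hR) (sub_pos.mpr hRS))
    obtain ⟨hγR, hγRS⟩ := lt_min_iff.mp hγlt
    exact eventually_exists_code_attains (hUB (γ / 2) (half_pos hγ)) (hUT (γ / 2) (half_pos hγ))
      (hST (γ / 2) (half_pos hγ)) (by positivity) (by positivity) hR0 (by linarith)
      (by linarith) hε

theorem exists_lt_sub_of_le_sSup_sub_sInf {p q : ℝ → Prop} {r r' : ℝ}
    (h : (r : EReal) ≤ sSup {e : EReal | ∃ a : ℝ, e = (a : EReal) ∧ p a} -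
      sInf {e : EReal | ∃ b : ℝ, e = (b : EReal) ∧ q b}) (hr : r' < r) :
    ∃ a b : ℝ, p a ∧ q b ∧ r' < a - b := by
  have hadd := EReal.add_lt_of_lt_sub ((EReal.coe_lt_coe_iff.mpr hr).trans_le h)
  obtain ⟨_, ⟨a, rfl, ha⟩, hlt⟩ := lt_sSup_iff.mp hadd
  rw [add_comm, ← EReal.lt_sub_iff_add_lt (Or.inl (EReal.coe_ne_bot _))
    (Or.inl (EReal.coe_ne_top _))] at hlt
  obtain ⟨_, ⟨b, rfl, hb⟩, hab⟩ := sInf_lt_iff.mp hlt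
  rw [← EReal.coe_sub, EReal.coe_lt_coe_iff] at hab
  exact ⟨a, b, ha, hb, lt_sub_comm.mp hab⟩

theorem mem_capacityRegion_of_le {r : ℝ × ℝ} (hr₁ : (r.1 : EReal) ≤ infoUB N P - infoUT N P)
    (hr₂ : infoST N P ≤ (r.2 : EReal)) : r ∈ capacityRegion N := by
  refine mem_capacityRegion_iff.mpr fun δ hδ => ?_
  obtain ⟨a, b, ha, hb, hab⟩ := exists_lt_sub_of_le_sSup_sub_sInf hr₁ (sub_lt_self r.1 hδ)
  obtain ⟨_, ⟨c, rfl, hc⟩, hcRS⟩ := sInf_lt_iff.mp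
    (hr₂.trans_lt (EReal.coe_lt_coe_iff.mpr (lt_add_of_pos_right r.2 hδ)))
  exact eventually_exists_code_attains_of_spectral ha hb hc hab (EReal.coe_lt_coe_iff.mp hcRS) hδ

end Direct

section Converse

theorem exists_tendsto_eventually_diagonal {p : ℕ → ℕ → Prop} (h : ∀ k, ∀ᶠ n in atTop, p k n) :
    ∃ φ : ℕ → ℕ, Tendsto φ atTop atTop ∧ ∀ᶠ n in atTop, p (φ n) n := by
  classical
  refine ⟨fun n => Nat.findGreatest (fun k => p k n) n, tendsto_atTop.mpr fun k => ?_, ?_⟩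
  · filter_upwards [h k, eventually_ge_atTop k] with n hn hk
    exact Nat.le_findGreatest hk hn
  · filter_upwards [h 0] with n hn
    exact Nat.findGreatest_spec (P := fun k => p k n) (Nat.zero_le n) hn

theorem exists_code_seq_attains_of_mem_capacityRegion {X S B : Type*} [Fintype X] [Fintype S]
    [Fintype B] [DecidableEq B] {N : ChannelSeq X S B} {r : ℝ × ℝ} (hr : r ∈ capacityRegion N) :
    ∃ (C : ∀ n, Code X S B n) (η : ℕ → ℝ), Tendsto η atTop (𝓝 0) ∧
      ∀ᶠ n in atTop, (C n).Attains N (η n) (r.1 - η n) (r.2 + η n) := by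
  obtain ⟨φ, hφ, hattains⟩ := exists_tendsto_eventually_diagonal fun k : ℕ =>
    mem_capacityRegion_iff.mp hr (1 / ((k : ℝ) + 1)) (by positivity)
  obtain ⟨C, hC⟩ := exists_code_seq hattains
  exact ⟨C, fun n => 1 / ((φ n : ℝ) + 1), tendsto_one_div_add_atTop_nhds_zero_nat.comp hφ, hC⟩

namespace Code

open scoped MatrixOrder

section Kernels

variable {X S B : Type*} [Fintype X] [Fintype B] [DecidableEq B] {n : ℕ} (C : Code X S B n)

theorem povm_le_one (m : Fin C.M) : C.povm m ≤ 1 := by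
  rw [← C.povm_sum]
  exact Finset.single_le_sum (fun i _ => (C.povm_posSemidef i).nonneg) (Finset.mem_univ m)

/-- The conditional distributions induced by a code: `S̃` is the encoded state, and `U` is a
uniformly distributed message independent of `S̃`. -/
noncomputable def kernels : AuxKernels X S (Fin C.Me) (Fin C.M) n where
  pT s := Pi.single (C.stateEnc s) 1
  pT_mem s := single_mem_stdSimplex ℝ _
  pU _ _ := 1 / (C.M : ℝ)
  pU_mem _ := ⟨fun _ => by positivity, by simp [C.M_pos.ne']⟩
  pX := C.enc
  pX_mem := C.enc_mem

variable [Fintype S] (N : ChannelSeq X S B)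

theorem distU_kernels (m : Fin C.M) : C.kernels.distU N m = 1 / (C.M : ℝ) :=
  calc ∑ t, C.kernels.distT N t * (1 / (C.M : ℝ)) = 1 / (C.M : ℝ) := by
        rw [← Finset.sum_mul, (C.kernels.distT_mem N).2, one_mul]

theorem born_outU_kernels (Λ : Matrix (Fin n → B) (Fin n → B) ℂ) (m : Fin C.M) :
    born Λ (C.kernels.outU N m) = 1 / (C.M : ℝ) * ∑ s, N.stateDist n s *
      born Λ (∑ x, C.enc m (C.stateEnc s) x • N.out x s) := by
  simp only [AuxKernels.born_outU, AuxKernels.born_outTU, kernels, Pi.single_apply, mul_ite,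
    mul_one, mul_zero, ite_mul, zero_mul, ← Finset.mul_sum]
  rw [Finset.sum_comm]
  simp only [Finset.sum_ite_eq', Finset.mem_univ, if_true, AuxKernels.outAvg]

theorem error_eq_sum_born_outU :
    C.error N = ∑ m, born (1 - C.povm m) (C.kernels.outU N m) := by
  simp only [error_eq, born_outU_kernels, Finset.mul_sum]

theorem probInfoDensityGT_jointUT_kernels (hn : 0 < n) {x : ℝ} (hx : 0 ≤ x) :
    probInfoDensityGT n (C.kernels.jointUT N) x = 0 := by
  rw [AuxKernels.probInfoDensityGT_jointUT _ _ hn]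
  refine Finset.sum_eq_zero fun t _ => mul_eq_zero_of_right _ <|
    Finset.sum_eq_zero fun m _ => if_neg ?_
  rw [distU_kernels, not_lt]
  exact le_mul_of_one_le_left ((C.kernels.pU_mem t).1 m)
    (Real.one_le_rpow one_le_two (by positivity))

end Kernels

section Tests

variable {X S B : Type*} [Fintype X] [DecidableEq X] [Fintype S] [DecidableEq S] [Fintype B]
  [DecidableEq B] {n : ℕ} (C : Code X S B n) (N : ChannelSeq X S B)

theorem born_povm_stateUB_kernels :
    born (cqMatrix C.povm) (C.kernels.stateUB N) = 1 - C.error N := by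
  rw [← C.kernels.born_one_stateUB N, error_eq_sum_born_outU, AuxKernels.stateUB_eq_cqMatrix,
    born_cqMatrix, born_cqMatrix, ← Finset.sum_sub_distrib]
  simp only [diagBlock_cqMatrix, diagBlock_one, map_sub, LinearMap.sub_apply, sub_sub_cancel]

theorem born_povm_stateU_kronecker_stateB_kernels :
    born (cqMatrix C.povm) (C.kernels.stateU N ⊗ₖ C.kernels.stateB N) = 1 / (C.M : ℝ) := by
  simp only [AuxKernels.stateU_kronecker_stateB_eq_cqMatrix, born_cqMatrix, diagBlock_cqMatrix,
    distU_kernels, map_smul, smul_eq_mul, ← Finset.mul_sum]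
  rw [← LinearMap.sum_apply, ← map_sum, C.povm_sum, AuxKernels.born_one_stateB, mul_one]

theorem one_sub_error_sub_le {c : ℝ} (hc : 0 ≤ c) :
    1 - C.error N - c * (1 / (C.M : ℝ)) ≤
      born (C.kernels.test N c) (C.kernels.stateUB N) := by
  rw [← born_povm_stateUB_kernels, ← born_povm_stateU_kronecker_stateB_kernels C N]
  exact C.kernels.le_born_test_stateUB N hc
    (cqMatrix_nonneg fun m => (C.povm_posSemidef m).nonneg) (cqMatrix_le_one C.povm_le_one)

end Tests

end Code

section Asymptotics

variable {X S B : Type*} [Fintype X] [Fintype S] [Fintype B] [DecidableEq B]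
  {N : ChannelSeq X S B} {C : ∀ n, Code X S B n}

theorem infoUT_kernels_nonpos : infoUT N (fun n => (C n).kernels) ≤ 0 := by
  refine sInf_le ⟨0, EReal.coe_zero.symm, fun γ hγ => tendsto_const_nhds.congr' ?_⟩
  filter_upwards [eventually_gt_atTop 0] with n hn
  exact ((C n).probInfoDensityGT_jointUT_kernels N hn (by linarith)).symm

variable {η : ℕ → ℝ} {R RS : ℝ}

theorem infoST_kernels_le (hη : Tendsto η atTop (𝓝 0))
    (hC : ∀ᶠ n in atTop, (C n).Attains N (η n) (R - η n) (RS + η n)) :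
    infoST N (fun n => (C n).kernels) ≤ (RS : EReal) := by
  refine sInf_le ⟨RS, rfl, fun γ hγ => ?_⟩
  refine tendsto_of_tendsto_of_tendsto_of_le_of_le' tendsto_const_nhds
    (tendsto_two_rpow_mul (neg_lt_zero.mpr (half_pos hγ))) ?_ ?_
  · filter_upwards [eventually_gt_atTop 0] with n hn
    exact (C n).kernels.probInfoDensityGT_jointST_nonneg N hn _
  · filter_upwards [hC, hη.eventually_lt_const (half_pos hγ), eventually_gt_atTop 0]
      with n hattains hηγ hn
    have hMe := ((Code.attains_iff hn).mp hattains).2.2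
    calc probInfoDensityGT n ((C n).kernels.jointST N) (RS + γ)
        ≤ (C n).Me * (2 : ℝ) ^ ((n : ℝ) * -(RS + γ)) := by
          simpa using (C n).kernels.probInfoDensityGT_jointST_le N hn (RS + γ)
      _ ≤ (2 : ℝ) ^ ((n : ℝ) * (RS + η n)) * (2 : ℝ) ^ ((n : ℝ) * -(RS + γ)) := by gcongr
      _ = (2 : ℝ) ^ ((n : ℝ) * (η n - γ)) := by
          rw [← Real.rpow_add two_pos, ← mul_add]
          ring_nf
      _ ≤ (2 : ℝ) ^ ((n : ℝ) * -(γ / 2)) := by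
          gcongr
          exacts [one_le_two, by linarith]

variable [DecidableEq X] [DecidableEq S]

theorem le_infoUB_kernels (hη : Tendsto η atTop (𝓝 0))
    (hC : ∀ᶠ n in atTop, (C n).Attains N (η n) (R - η n) (RS + η n)) :
    (R : EReal) ≤ infoUB N fun n => (C n).kernels := by
  refine le_sSup ⟨R, rfl, fun γ hγ => ?_⟩
  have hlower : Tendsto (fun n : ℕ => 1 - η n - (2 : ℝ) ^ ((n : ℝ) * -(γ / 2))) atTop
      (𝓝 (1 - 0 - 0)) :=
    (hη.const_sub 1).sub (tendsto_two_rpow_mul (neg_lt_zero.mpr (half_pos hγ)))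
  rw [sub_zero, sub_zero] at hlower
  refine tendsto_of_tendsto_of_tendsto_of_le_of_le' hlower tendsto_const_nhds ?_
    (Eventually.of_forall fun n => (C n).kernels.born_test_stateUB_le_one N _)
  filter_upwards [hC, hη.eventually_lt_const (half_pos hγ), eventually_gt_atTop 0]
    with n hattains hηγ hn
  obtain ⟨herror, hM, -⟩ := (Code.attains_iff hn).mp hattains
  have hguess : (2 : ℝ) ^ ((n : ℝ) * (R - γ)) * (1 / ((C n).M : ℝ)) ≤
      (2 : ℝ) ^ ((n : ℝ) * -(γ / 2)) := by
    rw [mul_one_div, div_le_iff₀ (Nat.cast_pos.mpr (C n).M_pos)]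
    calc (2 : ℝ) ^ ((n : ℝ) * (R - γ))
        ≤ (2 : ℝ) ^ ((n : ℝ) * (-(γ / 2) + (R - η n))) := by
          gcongr
          exacts [one_le_two, by linarith]
      _ = (2 : ℝ) ^ ((n : ℝ) * -(γ / 2)) * (2 : ℝ) ^ ((n : ℝ) * (R - η n)) := by
          rw [mul_add, Real.rpow_add two_pos]
      _ ≤ (2 : ℝ) ^ ((n : ℝ) * -(γ / 2)) * (C n).M := by gcongr
  calc 1 - η n - (2 : ℝ) ^ ((n : ℝ) * -(γ / 2))
      ≤ 1 - (C n).error N - (2 : ℝ) ^ ((n : ℝ) * (R - γ)) * (1 / ((C n).M : ℝ)) := by gcongr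
    _ ≤ _ := (C n).one_sub_error_sub_le N (by positivity)

theorem exists_kernels_of_mem_capacityRegion {r : ℝ × ℝ} (hr : r ∈ capacityRegion N) :
    ∃ (t u : ℕ → ℕ) (P : ∀ n, AuxKernels X S (Fin (t n)) (Fin (u n)) n),
      (r.1 : EReal) ≤ infoUB N P - infoUT N P ∧ infoST N P ≤ (r.2 : EReal) := by
  obtain ⟨C, η, hη, hC⟩ := exists_code_seq_attains_of_mem_capacityRegion hr
  refine ⟨fun n => (C n).Me, fun n => (C n).M, fun n => (C n).kernels, ?_,
    infoST_kernels_le hη hC⟩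
  simpa only [sub_zero] using EReal.sub_le_sub (le_infoUB_kernels hη hC) infoUT_kernels_nonpos

end Asymptotics

end Converse

end CQGP

/-- The capacity region is the union, over all sequences of states of the Markov form (with
arbitrary finite auxiliary alphabets), of the sets of rate pairs satisfying the two bounds. -/
theorem theorem3 {X S B : Type*} [Fintype X] [DecidableEq X] [Fintype S] [DecidableEq S]
    [Fintype B] [DecidableEq B] (N : CQGP.ChannelSeq X S B) :
    CQGP.capacityRegion N =
      {r : ℝ × ℝ | ∃ (t u : ℕ → ℕ) (P : ∀ n, CQGP.AuxKernels X S (Fin (t n)) (Fin (u n)) n),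
        (r.1 : EReal) ≤ CQGP.infoUB N P - CQGP.infoUT N P ∧
        CQGP.infoST N P ≤ (r.2 : EReal)} := by
  ext r
  exact ⟨CQGP.exists_kernels_of_mem_capacityRegion,
    fun ⟨_, _, _, hR, hRS⟩ => CQGP.mem_capacityRegion_of_le hR hRS⟩
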